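/- **Parameters.** Let $\mathit{Lock}$, $\mathit{Var}$ be finite sets, $\mathit{Val}$ a set with a distinguished element $0$, $\mathit{Reg}$ a nonempty set. Shared variables are $X=\mathit{Lock}\sqcup\mathit{Var}$; a memory is a map $X\to\mathit{Val}$; a mode state $\mathit{mds}$ assigns a subset of $X$ to each of the modes $\mathrm{AsmNoW},\mathrm{AsmNoRW},\mathrm{GuarNoW},\mathrm{GuarNoRW}$. Given are a classification $\mathcal L(\mathit{mem},x)\in\{\mathrm{High},\mathrm{Low}\}$; sets $W_k,RW_k\subseteq\mathit{Var}$ for each lock $k$; a predicate $\mathit{held}$ on $\mathit{Val}$; and values $t,f$ with $\mathit{held}(t)$ and $\neg\mathit{held}(f)$. Write $y\in\mathrm{Cv}(x)$ if two memories that agree off $y$ can classify $x$ differently, and $\mathcal C=\bigcup_x\mathrm{Cv}(x)$. Assume: variables in $\mathcal C$ and all locks are always $\mathrm{Low}$; no lock is in $\mathcal C$; if $c\in\mathrm{Cv}(v)$ with $c,v\in\mathit{Var}$, then for all $k$, $c\in W_k\iff v\in W_k$ and $c\in RW_k\iff v\in RW_k$; each program variable belongs to $W_k\cup RW_k$ for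 at most one $k$; and for all $k$, $W_k\cup RW_k\neq\emptyset$ and $W_k\cap RW_k=\emptyset$. Let $\mathrm{NoLocksHeld}(\mathit{mem})$ mean $\neg\mathit{held}(\mathit{mem}(k))$ for all $k$. Let $\mathrm{InitMds}$ have $\mathrm{GuarNoW}=\bigcup_kW_k$, $\mathrm{GuarNoRW}=\bigcup_kRW_k$ and no assumptions. **Security.** A local configuration $\langle s,\mathit{mds},\mathit{mem}\rangle$ has a thread-private state $s$. A variable is readable in $\mathit{mds}$ if it is not in $\mathrm{AsmNoRW}$, and writable if it is in neither $\mathrm{AsmNoW}$ nor $\mathrm{AsmNoRW}$. Write $\mathit{mem}_1=_{\mathrm{Low}}\mathit{mem}_2$ if $\mathit{mem}_1(x)=\mathit{mem}_2(x)$ whenever $\mathcal L(\mathit{mem}_1,x)=\mathrm{Low}$; and $\mathit{mem}_1=_{\mathit{mds}}\mathit{mem}_2$ if this equality holds whenever $x\in\mathcal C$, or $\mathcal L(\mathit{mem}_1,x)=\mathrm{Low}$ and $x$ is readable. A strong low-bisimulation modulo modes is a symmetric relation $\mathcal B$ on local configurations such that 1. related configurations with the same mode state have memories with $\mathit{mem}_1=_{\mathit{mds}}\mathit{mem}_2$,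 and each step of the first is matched by a step of the second to related configurations with equal mode states; 2. if $\langle s_1,\mathit{mds},\mathit{mem}_1\rangle\,\mathcal B\,\langle s_2,\mathit{mds},\mathit{mem}_2\rangle$, then also $\langle s_1,\mathit{mds},\mathit{mem}_1'\rangle\,\mathcal B\,\langle s_2,\mathit{mds},\mathit{mem}_2'\rangle$ for all $\mathit{mem}_1'=_{\mathit{mds}}\mathit{mem}_2'$ such that every $x$ with $\mathit{mem}_1(x)\ne\mathit{mem}_1'(x)$, $\mathit{mem}_2(x)\neq\mathit{mem}_2'(x)$ or $\mathcal L(\mathit{mem}_1,x)\ne\mathcal L(\mathit{mem}_1',x)$ is writable in $\mathit{mds}$. $\mathrm{ComSecure}(I,Q)(s,\mathit{mds})$: for all $\mathit{mem}_1=_{\mathit{mds}}\mathit{mem}_2$ satisfying $I$ some strong low-bisimulation modulo modes satisfying $Q$ relates $\langle s,\mathit{mds},\mathit{mem}_1\rangle$ to $\langle s,\mathit{mds},\mathit{mem}_2\rangle$. A system is a finite list $\mathit{cms}$ of pairs (thread-private state, mode state) running on one memory; a schedule is a finite list of thread indices, each of which makes that thread take one step. $\mathrm{SysSecure}(I)(\mathit{cms})$: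 for all $\mathit{mem}_1=_{\mathrm{Low}}\mathit{mem}_2$ satisfying $I$, every schedule, and every run $(\mathit{cms},\mathit{mem}_1)\to(\mathit{cms}_1',\mathit{mem}_1')$ along it, there is a run from $(\mathit{cms},\mathit{mem}_2)$ along it; and for each such run, to $(\mathit{cms}_2',\mathit{mem}_2')$, the lists $\mathit{cms}_1',\mathit{cms}_2'$ have equal lengths and equal lists of mode states, and $\mathit{mem}_1'(x)=\mathit{mem}_2'(x)$ for all $x$ such that $x\in\mathcal C$, or $\mathcal L(\mathit{mem}_1',x)=\mathrm{Low}$ and $x$ is readable in every thread's mode state in $\mathit{cms}_1'$. **While.** Expressions are $e::=n\mid v\mid e\oplus e$ with $n\in\mathit{Val}$, $v\in\mathit{Var}$, $\oplus:\mathit{Val}^2\to\mathit{Val}$. Commands are $\mathsf{Stop}$, $\mathsf{Skip}$, $c_1;c_2$, $\mathsf{If}\,e\,c_1\,c_2$, $\mathsf{While}\,e\,c$, $v:=e$, $\mathsf{Acq}\,k$, $\mathsf{Rel}\,k$; the command is the thread-private state. The semantics is small-step: $\mathsf{Skip}$ and $v:=e$ (atomically) step to $\mathsf{Stop}$; $c_1;c_2$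 steps $c_1$; $\mathsf{Stop};c$ steps to $c$; $\mathsf{If}$ takes its first branch iff the value of $e$ is nonzero; $\mathsf{While}\,e\,c$ steps to $\mathsf{If}\,e\,(c;\mathsf{While}\,e\,c)\,\mathsf{Stop}$. If $\mathit{held}(\mathit{mem}(k))$, then $\mathsf{Acq}\,k$ steps to the same configuration; otherwise it steps to $\mathsf{Stop}$, sets $k$ to $t$, removes $W_k$ from $\mathrm{GuarNoW}$ and $RW_k$ from $\mathrm{GuarNoRW}$, and adds $W_k$ to $\mathrm{AsmNoW}$ and $RW_k$ to $\mathrm{AsmNoRW}$. If $W_k$ is included in $\mathrm{AsmNoW}$ and disjoint from $\mathrm{GuarNoW}$, and $RW_k$ likewise for $\mathrm{AsmNoRW}$ and $\mathrm{GuarNoRW}$, then $\mathsf{Rel}\,k$ steps to $\mathsf{Stop}$, sets $k$ to $f$ and makes the converse changes of modes; otherwise it steps to the same configuration. $\mathrm{NoHighBranching}(\mathcal B)$: whenever $\langle c,\mathit{mds},\mathit{mem}\rangle\,\mathcal B\,\langle c',\mathit{mds},\mathit{mem}'\rangle$, then $c=c'$, and if the leftmost command of $c$ in its sequence is $\mathsf{If}\,e\,c_1\,c_2$,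 then $e$ has the same value in $\mathit{mem}$ and $\mathit{mem}'$. **RISC.** A program text $P$ is a list of optionally labelled (by natural numbers) instructions $\mathsf{Load}\,r\,v$, $\mathsf{Store}\,v\,r$, $\mathsf{Jmp}\,l$, $\mathsf{Jz}\,l\,r$ (jump if $r$ holds $0$), $\mathsf{Nop}$, $\mathsf{Nop}'$ (a second no-op), $\mathsf{MoveK}\,r\,n$, $\mathsf{MoveR}\,r\,r'$, $\mathsf{Op}\oplus r\,r'$ (which sets $r$ to $r\oplus r'$), $\mathsf{Acq}\,k$, $\mathsf{Rel}\,k$. The thread-private state is $((\mathit{pc},P),\mathit{regs})$ with $\mathit{regs}:\mathit{Reg}\to\mathit{Val}$. The semantics is the usual one; $\mathsf{Acq}$ and $\mathsf{Rel}$ act on memory and modes as in While, incrementing $\mathit{pc}$ on success and leaving it unchanged otherwise. A jump to $l$ goes to the first instruction labelled $l$, or to the end of $P$ if there is none. A thread has no step once $\mathit{pc}\ge|P|$. **Compiler.** A compilation record $C=(\Phi,(S_1,S_2))$ consists of a partial map $\Phi$ from registers to expressions and sets $S_1,S_2\subseteq X$; $\mathrm{InitComprec}=(\emptyset,(\emptyset,\emptyset))$.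 A variable $x$ is stable in $C$ if $\{x\}\cup\mathrm{Cv}(x)\subseteq S_1\cup S_2$. Acquiring $k$ replaces $(S_1,S_2)$ by $(S_1\cup W_k,S_2\cup RW_k)$, releasing it replaces it by $(S_1\setminus W_k,S_2\setminus RW_k)$; assumptions after a command are computed from this compositionally (for $\mathsf{If}$ those of the first branch, for $\mathsf{While}$ unchanged). $\mathrm{CompilerInputReqs}\,C\,l\,\mathit{nl}\,c$, for an optional label $l$ and a next unused label $\mathit{nl}\in\mathbb N$, says: $c\ne\mathsf{Stop}$; $l<\mathit{nl}$ if $l$ is present; expressions in the range of $\Phi$ mention stable variables only; and in $c$, started from $C$, all expressions mention only variables that are stable at that point, variables assigned to are stable there or lie in no $W_k\cup RW_k$, the branches of each conditional end with the same $(S_1,S_2)$, and each loop body restores $(S_1,S_2)$. Register allocation is given by any two partial functions: $\mathrm{alloc}(\Phi,A)$, with values outside $A$, and $\mathrm{cached}(\Phi,A,v)$, with values $r\notin A$ such that $\Phi(r)=v$ (here $A\subseteq\mathit{Reg}$). $\mathrm{CompileExpr}\,C\,A\,l\,e$ returns code, a result register and a new record. A constant gives $\mathsf{MoveK}$ to an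 allocated register. A variable gives no code if it is cached, and otherwise a $\mathsf{Load}$ to an allocated register. For $e_1\oplus e_2$ it compiles $e_1$ to $r_1$ with $A$, then $e_2$ to $r_2$ with $A\cup\{r_1\}$, then emits $\mathsf{Op}\oplus r_1\,r_2$, with result in $r_1$. Each instruction emitted updates $\Phi$ by mapping its target register to the (sub)expression computed; the first instruction emitted carries $l$. It fails if an allocation does. $\mathrm{CompileCmd}\,C\,l\,\mathit{nl}\,c=(\mathit{PCs},l',\mathit{nl}',C',\mathit{failed})$, where each instruction in $\mathit{PCs}$ is paired with the record in force before it, the first instruction carries $l$, and $l'$ is the label for the next instruction after the code (absent for all commands without a rule for it below), is as follows. * $\mathsf{Skip}$: $\mathsf{Nop}$. $\mathsf{Acq}\,k$, $\mathsf{Rel}\,k$: the same RISC instruction, updating $(S_1,S_2)$; after $\mathsf{Rel}\,k$, entries of $\Phi$ that mention a variable no longer stable are flushed. * $v:=e$: code for $e$ (with $A=\emptyset$) with result in $r$, then $\mathsf{Store}\,v\,r$; afterwards entries of $\Phi$ that mention $v$ are flushed. * $c_1;c_2$: the code for $c_1$ followed by that for $c_2$, threading label, label counter and record; $l'$ is that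 of $c_2$. * $\mathsf{If}\,e\,c_1\,c_2$: with $br=\mathit{nl}$, $ex=\mathit{nl}+1$, code for $e$ (with $A=\emptyset$) giving $(r,C_1)$; $\mathsf{Jz}\,br\,r$; code for $c_1$ from $C_1$ with no label and counter $\mathit{nl}+2$; $\mathsf{Jmp}\,ex$, carrying the label returned for $c_1$; code for $c_2$ from $C_1$ with label $br$ and the counter returned for $c_1$; $\mathsf{Nop}'$, carrying the label returned for $c_2$. Then $l'=ex$; $C'$ has the register entries on which the records after $c_1$ and after $c_2$ agree, and the sets $(S_1,S_2)$ after $c_1$. * $\mathsf{While}\,e\,c$: with $lp=l$ (or a fresh label if $l$ is absent) and a fresh $ex$, all register entries are flushed; code for $e$ with label $lp$ (with $A=\emptyset$) giving $(r,C_1)$; $\mathsf{Jz}\,ex\,r$; code for $c$ from $C_1$ with no label; $\mathsf{Jmp}\,lp$, carrying the label returned for $c$. Then $l'=ex$ and $C'=C_1$. It fails on $\mathsf{Stop}$, if a subcompilation fails, or if $\mathrm{CompilerInputReqs}\,C\,l\,\mathit{nl}\,c$ is violated. **Theorem.** Let $\mathit{cms}_r$ be a finite list of pairs (RISC thread-private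 state, mode state). Suppose that for every $i<|\mathit{cms}_r|$ there are a While command $c$ and $l,\mathit{nl},\mathit{PCs},l',\mathit{nl}',C',\mathit{regs}$ with * $\mathrm{ComSecure}(\mathrm{NoLocksHeld},\mathrm{NoHighBranching})\,(c,\mathrm{InitMds})$ for the While semantics; * $(\mathit{PCs},l',\mathit{nl}',C',\mathrm{False})=\mathrm{CompileCmd}\ \mathrm{InitComprec}\ l\ \mathit{nl}\ c$, and $\mathrm{CompilerInputReqs}\ \mathrm{InitComprec}\ l\ \mathit{nl}\ c$; * $\mathit{cms}_r[i]=(((0,P),\mathit{regs}),\mathrm{InitMds})$, where $P$ is $\mathit{PCs}$ without its records. Then $\mathrm{SysSecure}(\mathrm{NoLocksHeld})(\mathit{cms}_r)$ holds for the RISC semantics. -/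

import Mathlib

/-! ## Concurrent value-dependent noninterference, for an arbitrary thread semantics

`X` is the type of shared variables, `Val` the type of values and `Tps` the type of
thread-private states. -/

namespace CVDNI

inductive Sec where
  | high
  | low

inductive Mode where
  | asmNoW
  | asmNoRW
  | guarNoW
  | guarNoRW

abbrev Mem (X Val : Type*) := X → Val

abbrev Mds (X : Type*) := Mode → Set X

/-- Local configurations `⟨tps, mds, mem⟩`. -/
abbrev LocalConf (Tps X Val : Type*) := (Tps × Mds X) × Mem X Val

/-- Global configurations `(cms, mem)`. -/
abbrev GlobalConf (Tps X Val : Type*) := List (Tps × Mds X) × Mem X Val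

section Generic

variable {Tps X Val : Type*}

/-- The control variables of `x`: changing such a variable alone can change the
classification of `x`. -/
def Cvars (dma : Mem X Val → X → Sec) (x : X) : Set X :=
  {y | ∃ mem mem' : Mem X Val, (∀ z, z ≠ y → mem z = mem' z) ∧ dma mem x ≠ dma mem' x}

/-- All control variables of the system. -/
def Cset (dma : Mem X Val → X → Sec) : Set X :=
  {y | ∃ x, y ∈ Cvars dma x}

def LowEq (dma : Mem X Val → X → Sec) (mem₁ mem₂ : Mem X Val) : Prop :=
  ∀ x, dma mem₁ x = Sec.low → mem₁ x = mem₂ x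

def Readable (mds : Mds X) (x : X) : Prop :=
  x ∉ mds Mode.asmNoRW

def Writable (mds : Mds X) (x : X) : Prop :=
  x ∉ mds Mode.asmNoW ∧ x ∉ mds Mode.asmNoRW

/-- Low-equivalence of memories modulo the mode state `mds`. -/
def LowEqModulo (dma : Mem X Val → X → Sec) (mds : Mds X) (mem₁ mem₂ : Mem X Val) : Prop :=
  ∀ x, (x ∈ Cset dma ∨ (dma mem₁ x = Sec.low ∧ Readable mds x)) → mem₁ x = mem₂ x

/-- Closedness under globally consistent changes. -/
def CgConsistent (dma : Mem X Val → X → Sec)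
    (B : LocalConf Tps X Val → LocalConf Tps X Val → Prop) : Prop :=
  ∀ (tps₁ : Tps) (mem₁ : Mem X Val) (tps₂ : Tps) (mem₂ : Mem X Val) (mds : Mds X),
    B ((tps₁, mds), mem₁) ((tps₂, mds), mem₂) →
    ∀ mem₁' mem₂' : Mem X Val,
      (∀ x, (mem₁ x ≠ mem₁' x ∨ mem₂ x ≠ mem₂' x ∨ dma mem₁ x ≠ dma mem₁' x) →
        Writable mds x) →
      LowEqModulo dma mds mem₁' mem₂' →
      B ((tps₁, mds), mem₁') ((tps₂, mds), mem₂')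

/-- Strong low-bisimulation modulo modes. -/
def StrongLowBisimMM (dma : Mem X Val → X → Sec)
    (eval : LocalConf Tps X Val → LocalConf Tps X Val → Prop)
    (B : LocalConf Tps X Val → LocalConf Tps X Val → Prop) : Prop :=
  CgConsistent dma B ∧
  (∀ lc₁ lc₂, B lc₁ lc₂ → B lc₂ lc₁) ∧
  ∀ lc₁ lc₂, B lc₁ lc₂ → lc₁.1.2 = lc₂.1.2 →
    LowEqModulo dma lc₁.1.2 lc₁.2 lc₂.2 ∧
    ∀ lc₁', eval lc₁ lc₁' →
      ∃ lc₂', eval lc₂ lc₂' ∧ lc₁'.1.2 = lc₂'.1.2 ∧ B lc₁' lc₂'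

/-- Per-thread security, with requirements `INIT` on the initial memory and
`BISIMREQS` on the witness bisimulations. -/
def ComSecure (dma : Mem X Val → X → Sec)
    (eval : LocalConf Tps X Val → LocalConf Tps X Val → Prop)
    (INIT : Mem X Val → Prop)
    (BISIMREQS : (LocalConf Tps X Val → LocalConf Tps X Val → Prop) → Prop)
    (cm : Tps × Mds X) : Prop :=
  ∀ mem₁ mem₂ : Mem X Val,
    LowEqModulo dma cm.2 mem₁ mem₂ → INIT mem₁ → INIT mem₂ →
    ∃ B : LocalConf Tps X Val → LocalConf Tps X Val → Prop,
      StrongLowBisimMM dma eval B ∧ BISIMREQS B ∧ B (cm, mem₁) (cm, mem₂)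

/-- The `n`th thread of a global configuration takes one step. -/
inductive GlobalStep (eval : LocalConf Tps X Val → LocalConf Tps X Val → Prop) (n : ℕ) :
    GlobalConf Tps X Val → GlobalConf Tps X Val → Prop where
  | step (cms : List (Tps × Mds X)) (mem : Mem X Val) (cm' : Tps × Mds X) (mem' : Mem X Val)
      (hn : n < cms.length) (h : eval (cms[n], mem) (cm', mem')) :
      GlobalStep eval n (cms, mem) (cms.set n cm', mem')

/-- Execution of a global configuration along a finite schedule. -/
def EvalSched (eval : LocalConf Tps X Val → LocalConf Tps X Val → Prop) :
    List ℕ → GlobalConf Tps X Val → GlobalConf Tps X Val → Prop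
  | [], gc, gc' => gc = gc'
  | n :: ns, gc, gc' => ∃ gc'', GlobalStep eval n gc gc'' ∧ EvalSched eval ns gc'' gc'

/-- Whole-system value-dependent security, with requirement `INIT` on initial memories. -/
def SysSecure (dma : Mem X Val → X → Sec)
    (eval : LocalConf Tps X Val → LocalConf Tps X Val → Prop)
    (INIT : Mem X Val → Prop) (cms : List (Tps × Mds X)) : Prop :=
  ∀ mem₁ mem₂ : Mem X Val, INIT mem₁ → INIT mem₂ → LowEq dma mem₁ mem₂ →
    ∀ (sched : List ℕ) (cms₁' : List (Tps × Mds X)) (mem₁' : Mem X Val),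
      EvalSched eval sched (cms, mem₁) (cms₁', mem₁') →
      (∃ (cms₂' : List (Tps × Mds X)) (mem₂' : Mem X Val),
        EvalSched eval sched (cms, mem₂) (cms₂', mem₂')) ∧
      ∀ (cms₂' : List (Tps × Mds X)) (mem₂' : Mem X Val),
        EvalSched eval sched (cms, mem₂) (cms₂', mem₂') →
        cms₁'.length = cms₂'.length ∧
        cms₁'.map Prod.snd = cms₂'.map Prod.snd ∧
        ∀ x, (x ∈ Cset dma ∨
            (dma mem₁' x = Sec.low ∧
              ∀ (i : ℕ) (hi : i < cms₁'.length), Readable cms₁'[i].2 x)) →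
          mem₁' x = mem₂' x

end Generic

/-! ## Locking disciplines

Shared variables are `Lock ⊕ Var`: `Sum.inl k` is a lock-variable, `Sum.inr v` a
program-variable. -/

/-- The data supplied by the program developer. `lockInterp k` gives the sets of
program-variables over which lock `k` grants exclusive permission to write, and to
read and write, respectively; `evLock` says of a value whether it means "held". -/
structure LockDiscipline (Lock Var Val : Type*) where
  dma : Mem (Lock ⊕ Var) Val → Lock ⊕ Var → Sec
  lockInterp : Lock → Set Var × Set Var
  evLock : Val → Prop
  lockTrue : Val
  lockFalse : Val

namespace LockDiscipline

variable {Lock Var Val : Type*} (D : LockDiscipline Lock Var Val)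

def noWvars (k : Lock) : Set Var := (D.lockInterp k).1

def noRWvars (k : Lock) : Set Var := (D.lockInterp k).2

/-- `noWvars`, as a set of shared variables. -/
def noW (k : Lock) : Set (Lock ⊕ Var) := Sum.inr '' D.noWvars k

/-- `noRWvars`, as a set of shared variables. -/
def noRW (k : Lock) : Set (Lock ⊕ Var) := Sum.inr '' D.noRWvars k

/-- Program-variable `v` is governed by some lock. -/
def LockGoverned (v : Var) : Prop := ∃ k, v ∈ D.noWvars k ∪ D.noRWvars k

/-- The standing restrictions on classification functions and locking disciplines. -/
structure WellFormed : Prop where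
  evLock_lockTrue : D.evLock D.lockTrue
  not_evLock_lockFalse : ¬ D.evLock D.lockFalse
  control_low : ∀ x ∈ Cset D.dma, ∀ mem, D.dma mem x = Sec.low
  lock_not_control : ∀ k, Sum.inl k ∉ Cset D.dma
  lock_low : ∀ k mem, D.dma mem (Sum.inl k) = Sec.low
  control_same_lock : ∀ (c v : Var) (k : Lock), Sum.inr c ∈ Cvars D.dma (Sum.inr v) →
    (c ∈ D.noWvars k ↔ v ∈ D.noWvars k) ∧ (c ∈ D.noRWvars k ↔ v ∈ D.noRWvars k)
  lock_unique : ∀ (v : Var) (k : Lock), v ∈ D.noWvars k ∪ D.noRWvars k →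
    ∀ k' : Lock, v ∈ D.noWvars k' ∪ D.noRWvars k' → k' = k
  not_vacuous : ∀ k, D.noWvars k ∪ D.noRWvars k ≠ ∅
  no_overlap : ∀ k, D.noWvars k ∩ D.noRWvars k = ∅

/-- Impact on the mode state of acquiring lock `k`. -/
def lockAcqUpd (mds : Mds (Lock ⊕ Var)) (k : Lock) : Mds (Lock ⊕ Var)
  | Mode.guarNoW => mds Mode.guarNoW \ D.noW k
  | Mode.asmNoW => mds Mode.asmNoW ∪ D.noW k
  | Mode.guarNoRW => mds Mode.guarNoRW \ D.noRW k
  | Mode.asmNoRW => mds Mode.asmNoRW ∪ D.noRW k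

/-- Impact on the mode state of releasing lock `k`. -/
def lockRelUpd (mds : Mds (Lock ⊕ Var)) (k : Lock) : Mds (Lock ⊕ Var)
  | Mode.guarNoW => mds Mode.guarNoW ∪ D.noW k
  | Mode.asmNoW => mds Mode.asmNoW \ D.noW k
  | Mode.guarNoRW => mds Mode.guarNoRW ∪ D.noRW k
  | Mode.asmNoRW => mds Mode.asmNoRW \ D.noRW k

/-- The mode state is consistent with holding lock `k`. -/
def LockHeldMdsCorrect (mds : Mds (Lock ⊕ Var)) (k : Lock) : Prop :=
  ∀ x, (x ∈ D.noW k → x ∉ mds Mode.guarNoW ∧ x ∈ mds Mode.asmNoW) ∧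
    (x ∈ D.noRW k → x ∉ mds Mode.guarNoRW ∧ x ∈ mds Mode.asmNoRW)

def NoLocksHeld (mem : Mem (Lock ⊕ Var) Val) : Prop :=
  ∀ k, ¬ D.evLock (mem (Sum.inl k))

def initMds : Mds (Lock ⊕ Var)
  | Mode.guarNoW => ⋃ k, D.noW k
  | Mode.guarNoRW => ⋃ k, D.noRW k
  | Mode.asmNoW => ∅
  | Mode.asmNoRW => ∅

end LockDiscipline

/-! ## Expressions, and the source language While with mutex locks -/

inductive Expr (Var Val : Type*) where
  | const (n : Val)
  | var (v : Var)
  | op (f : Val → Val → Val) (e₁ e₂ : Expr Var Val)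

namespace Expr

variable {Lock Var Val : Type*}

def vars : Expr Var Val → Set Var
  | const _ => ∅
  | var v => {v}
  | op _ e₁ e₂ => e₁.vars ∪ e₂.vars

def eval (mem : Mem (Lock ⊕ Var) Val) : Expr Var Val → Val
  | const n => n
  | var v => mem (Sum.inr v)
  | op f e₁ e₂ => f (e₁.eval mem) (e₂.eval mem)

end Expr

/-- While commands; `halt` is the terminated program. -/
inductive Cmd (Lock Var Val : Type*) where
  | halt
  | skip
  | seq (c₁ c₂ : Cmd Lock Var Val)
  | ite (e : Expr Var Val) (c₁ c₂ : Cmd Lock Var Val)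
  | loop (e : Expr Var Val) (c : Cmd Lock Var Val)
  | assign (v : Var) (e : Expr Var Val)
  | lockAcq (k : Lock)
  | lockRel (k : Lock)

open Classical in
/-- Single-step semantics of While. A condition holds when its value is nonzero. -/
inductive EvalW {Lock Var Val : Type*} [Zero Val] (D : LockDiscipline Lock Var Val) :
    LocalConf (Cmd Lock Var Val) (Lock ⊕ Var) Val →
    LocalConf (Cmd Lock Var Val) (Lock ⊕ Var) Val → Prop where
  | skip (mds mem) : EvalW D ((Cmd.skip, mds), mem) ((Cmd.halt, mds), mem)
  | assign (v e mds mem) : EvalW D ((Cmd.assign v e, mds), mem)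
      ((Cmd.halt, mds), Function.update mem (Sum.inr v) (e.eval mem))
  | seq (c₁ c₂ mds mem c₁' mds' mem')
      (h : EvalW D ((c₁, mds), mem) ((c₁', mds'), mem')) :
      EvalW D ((Cmd.seq c₁ c₂, mds), mem) ((Cmd.seq c₁' c₂, mds'), mem')
  | seqHalt (c₂ mds mem) : EvalW D ((Cmd.seq Cmd.halt c₂, mds), mem) ((c₂, mds), mem)
  | iteTrue (e : Expr Var Val) (c₁ c₂ mds mem) (h : e.eval mem ≠ 0) :
      EvalW D ((Cmd.ite e c₁ c₂, mds), mem) ((c₁, mds), mem)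
  | iteFalse (e : Expr Var Val) (c₁ c₂ mds mem) (h : e.eval mem = 0) :
      EvalW D ((Cmd.ite e c₁ c₂, mds), mem) ((c₂, mds), mem)
  | loop (e c mds mem) : EvalW D ((Cmd.loop e c, mds), mem)
      ((Cmd.ite e (Cmd.seq c (Cmd.loop e c)) Cmd.halt, mds), mem)
  | lockAcq (k mds) (mem : Mem (Lock ⊕ Var) Val) (h : ¬ D.evLock (mem (Sum.inl k))) :
      EvalW D ((Cmd.lockAcq k, mds), mem)
        ((Cmd.halt, D.lockAcqUpd mds k), Function.update mem (Sum.inl k) D.lockTrue)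
  | lockSpin (k mds) (mem : Mem (Lock ⊕ Var) Val) (h : D.evLock (mem (Sum.inl k))) :
      EvalW D ((Cmd.lockAcq k, mds), mem) ((Cmd.lockAcq k, mds), mem)
  | lockRel (k mds mem) (h : D.LockHeldMdsCorrect mds k) :
      EvalW D ((Cmd.lockRel k, mds), mem)
        ((Cmd.halt, D.lockRelUpd mds k), Function.update mem (Sum.inl k) D.lockFalse)
  | lockInvalid (k mds mem) (h : ¬ D.LockHeldMdsCorrect mds k) :
      EvalW D ((Cmd.lockRel k, mds), mem) ((Cmd.lockRel k, mds), mem)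

/-- The leftmost command in a sequence of commands. -/
def Cmd.leftmost {Lock Var Val : Type*} : Cmd Lock Var Val → Cmd Lock Var Val
  | Cmd.seq c₁ _ => c₁.leftmost
  | c => c

/-- The extra requirement on While bisimulations that bans branching on secrets. -/
def NoHighBranching {Lock Var Val : Type*}
    (B : LocalConf (Cmd Lock Var Val) (Lock ⊕ Var) Val →
      LocalConf (Cmd Lock Var Val) (Lock ⊕ Var) Val → Prop) : Prop :=
  ∀ (c c' : Cmd Lock Var Val) (mds : Mds (Lock ⊕ Var)) (mem mem' : Mem (Lock ⊕ Var) Val),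
    B ((c, mds), mem) ((c', mds), mem') →
    c = c' ∧ ∀ e c₁ c₂, c.leftmost = Cmd.ite e c₁ c₂ → e.eval mem = e.eval mem'

/-! ## The target language RISC with mutex locks -/

/-- Labels are natural numbers. `nopEpilogue` behaves as `nop`; the compiler emits it only at
the end of a conditional. -/
inductive Instr (Lock Var Val Reg : Type*) where
  | load (r : Reg) (v : Var)
  | store (v : Var) (r : Reg)
  | jmp (l : ℕ)
  | jz (l : ℕ) (r : Reg)
  | nop
  | nopEpilogue
  | moveK (r : Reg) (n : Val)
  | moveR (r r' : Reg)
  | op (f : Val → Val → Val) (r r' : Reg)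
  | lockAcq (k : Lock)
  | lockRel (k : Lock)

/-- An instruction with its optional label. -/
abbrev LInstr (Lock Var Val Reg : Type*) := Option ℕ × Instr Lock Var Val Reg

/-- Thread-private state `((pc, P), regs)`. -/
abbrev RiscTps (Lock Var Val Reg : Type*) :=
  (ℕ × List (LInstr Lock Var Val Reg)) × (Reg → Val)

/-- The location that label `l` denotes in the program text `P`: the first instruction
labelled `l`, or the end of `P` if there is none. -/
def resolveLabel {Lock Var Val Reg : Type*} (P : List (LInstr Lock Var Val Reg)) (l : ℕ) : ℕ :=
  P.findIdx (fun I => I.1 == some l)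

open Classical in
/-- Single-step semantics of RISC. There is no step once `pc` is outside the program text. -/
inductive EvalR {Lock Var Val Reg : Type*} [Zero Val] (D : LockDiscipline Lock Var Val) :
    LocalConf (RiscTps Lock Var Val Reg) (Lock ⊕ Var) Val →
    LocalConf (RiscTps Lock Var Val Reg) (Lock ⊕ Var) Val → Prop where
  | load (pc P regs mds mem lab r v) (hI : P[pc]? = some (lab, Instr.load r v)) :
      EvalR D ((((pc, P), regs), mds), mem)
        ((((pc + 1, P), Function.update regs r (mem (Sum.inr v))), mds), mem)
  | store (pc P regs mds mem lab v r) (hI : P[pc]? = some (lab, Instr.store v r)) :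
      EvalR D ((((pc, P), regs), mds), mem)
        ((((pc + 1, P), regs), mds), Function.update mem (Sum.inr v) (regs r))
  | jmp (pc P regs mds mem lab l) (hI : P[pc]? = some (lab, Instr.jmp l)) :
      EvalR D ((((pc, P), regs), mds), mem) ((((resolveLabel P l, P), regs), mds), mem)
  | jzZero (pc P regs mds mem lab l r) (hI : P[pc]? = some (lab, Instr.jz l r))
      (h : regs r = 0) :
      EvalR D ((((pc, P), regs), mds), mem) ((((resolveLabel P l, P), regs), mds), mem)
  | jzNonzero (pc P regs mds mem lab l r) (hI : P[pc]? = some (lab, Instr.jz l r))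
      (h : regs r ≠ 0) :
      EvalR D ((((pc, P), regs), mds), mem) ((((pc + 1, P), regs), mds), mem)
  | nop (pc P regs mds mem lab) (hI : P[pc]? = some (lab, Instr.nop)) :
      EvalR D ((((pc, P), regs), mds), mem) ((((pc + 1, P), regs), mds), mem)
  | nopEpilogue (pc P regs mds mem lab) (hI : P[pc]? = some (lab, Instr.nopEpilogue)) :
      EvalR D ((((pc, P), regs), mds), mem) ((((pc + 1, P), regs), mds), mem)
  | moveK (pc P regs mds mem lab r n) (hI : P[pc]? = some (lab, Instr.moveK r n)) :
      EvalR D ((((pc, P), regs), mds), mem)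
        ((((pc + 1, P), Function.update regs r n), mds), mem)
  | moveR (pc P regs mds mem lab r r') (hI : P[pc]? = some (lab, Instr.moveR r r')) :
      EvalR D ((((pc, P), regs), mds), mem)
        ((((pc + 1, P), Function.update regs r (regs r')), mds), mem)
  | op (pc P regs mds mem lab f r r') (hI : P[pc]? = some (lab, Instr.op f r r')) :
      EvalR D ((((pc, P), regs), mds), mem)
        ((((pc + 1, P), Function.update regs r (f (regs r) (regs r'))), mds), mem)
  | lockAcq (pc P regs mds) (mem : Mem (Lock ⊕ Var) Val) (lab k)
      (hI : P[pc]? = some (lab, Instr.lockAcq k)) (h : ¬ D.evLock (mem (Sum.inl k))) :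
      EvalR D ((((pc, P), regs), mds), mem)
        ((((pc + 1, P), regs), D.lockAcqUpd mds k), Function.update mem (Sum.inl k) D.lockTrue)
  | lockSpin (pc P regs mds) (mem : Mem (Lock ⊕ Var) Val) (lab k)
      (hI : P[pc]? = some (lab, Instr.lockAcq k)) (h : D.evLock (mem (Sum.inl k))) :
      EvalR D ((((pc, P), regs), mds), mem) ((((pc, P), regs), mds), mem)
  | lockRel (pc P regs mds mem lab k) (hI : P[pc]? = some (lab, Instr.lockRel k))
      (h : D.LockHeldMdsCorrect mds k) :
      EvalR D ((((pc, P), regs), mds), mem)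
        ((((pc + 1, P), regs), D.lockRelUpd mds k), Function.update mem (Sum.inl k) D.lockFalse)
  | lockInvalid (pc P regs mds mem lab k) (hI : P[pc]? = some (lab, Instr.lockRel k))
      (h : ¬ D.LockHeldMdsCorrect mds k) :
      EvalR D ((((pc, P), regs), mds), mem) ((((pc, P), regs), mds), mem)

/-! ## The compiler -/

/-- Register records: the expression whose value a register is known to hold. -/
abbrev Regrec (Var Val Reg : Type*) := Reg → Option (Expr Var Val)

/-- Assumption records: the variables with an `asmNoW`, respectively `asmNoRW`, assumption. -/
abbrev Asmrec (Lock Var : Type*) := Set (Lock ⊕ Var) × Set (Lock ⊕ Var)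

/-- Compilation records. -/
abbrev Comprec (Lock Var Val Reg : Type*) := Regrec Var Val Reg × Asmrec Lock Var

/-- Program texts annotated with the compilation record before each instruction. -/
abbrev AnnText (Lock Var Val Reg : Type*) :=
  List (LInstr Lock Var Val Reg × Comprec Lock Var Val Reg)

/-- The user-supplied register allocation scheme; `none` means that it fails. The set argument
holds the registers that are in use for the current expression. -/
structure RegAlloc (Var Val Reg : Type*) where
  alloc : Regrec Var Val Reg → Set Reg → Option Reg
  allocCached : Regrec Var Val Reg → Set Reg → Var → Option Reg

structure RegAlloc.Correct {Var Val Reg : Type*} (R : RegAlloc Var Val Reg) : Prop where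
  alloc_notMem : ∀ Φ A r, R.alloc Φ A = some r → r ∉ A
  allocCached_notMem : ∀ Φ A v r, R.allocCached Φ A v = some r → r ∉ A
  allocCached_contains : ∀ Φ A v r, R.allocCached Φ A v = some r → Φ r = some (Expr.var v)

section Compiler

variable {Lock Var Val Reg : Type*}

def initComprec : Comprec Lock Var Val Reg := (fun _ => none, (∅, ∅))

/-- Variable `x` is recorded as stable. -/
def VarStable (D : LockDiscipline Lock Var Val) (S : Asmrec Lock Var) (x : Lock ⊕ Var) : Prop :=
  x ∈ S.1 ∪ S.2 ∧ ∀ y ∈ Cvars D.dma x, y ∈ S.1 ∪ S.2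

/-- All variables of `e` are recorded as stable. -/
def ExprStable (D : LockDiscipline Lock Var Val) (S : Asmrec Lock Var) (e : Expr Var Val) : Prop :=
  ∀ v ∈ e.vars, VarStable D S (Sum.inr v)

def RegrecStable (D : LockDiscipline Lock Var Val) (C : Comprec Lock Var Val Reg) : Prop :=
  ∀ r e, C.1 r = some e → ExprStable D C.2 e

def asmAcq (D : LockDiscipline Lock Var Val) (S : Asmrec Lock Var) (k : Lock) : Asmrec Lock Var :=
  (S.1 ∪ D.noW k, S.2 ∪ D.noRW k)

def asmRel (D : LockDiscipline Lock Var Val) (S : Asmrec Lock Var) (k : Lock) : Asmrec Lock Var :=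
  (S.1 \ D.noW k, S.2 \ D.noRW k)

/-- The assumption record after execution of a command. -/
def asmAfter (D : LockDiscipline Lock Var Val) : Cmd Lock Var Val → Asmrec Lock Var →
    Asmrec Lock Var
  | Cmd.seq c₁ c₂, S => asmAfter D c₂ (asmAfter D c₁ S)
  | Cmd.ite _ c₁ _, S => asmAfter D c₁ S
  | Cmd.lockAcq k, S => asmAcq D S k
  | Cmd.lockRel k, S => asmRel D S k
  | _, S => S

/-- The static checks, starting from a given assumption record: only stable variables are
read; an unstable variable is assigned to only if no lock governs it; the branches of a
conditional end with the same assumptions; a loop body restores the assumptions. -/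
def StabilityChecksAux (D : LockDiscipline Lock Var Val) : Cmd Lock Var Val → Asmrec Lock Var →
    Prop
  | Cmd.seq c₁ c₂, S => StabilityChecksAux D c₁ S ∧ StabilityChecksAux D c₂ (asmAfter D c₁ S)
  | Cmd.ite e c₁ c₂, S => ExprStable D S e ∧ StabilityChecksAux D c₁ S ∧
      StabilityChecksAux D c₂ S ∧ asmAfter D c₁ S = asmAfter D c₂ S
  | Cmd.loop e c, S => ExprStable D S e ∧ StabilityChecksAux D c S ∧ asmAfter D c S = S
  | Cmd.assign v e, S => ExprStable D S e ∧ (¬ VarStable D S (Sum.inr v) → ¬ D.LockGoverned v)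
  | _, _ => True

def StabilityChecks (D : LockDiscipline Lock Var Val) (c : Cmd Lock Var Val)
    (C : Comprec Lock Var Val Reg) : Prop :=
  StabilityChecksAux D c C.2

def CompilerInputReqs (D : LockDiscipline Lock Var Val) (C : Comprec Lock Var Val Reg)
    (l : Option ℕ) (nl : ℕ) (c : Cmd Lock Var Val) : Prop :=
  StabilityChecks D c C ∧ RegrecStable D C ∧ c ≠ Cmd.halt ∧ ∀ x, l = some x → x < nl

open Classical in
/-- Record that register `r` holds the value of `e`. -/
noncomputable def recordReg (C : Comprec Lock Var Val Reg) (r : Reg) (e : Expr Var Val) :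
    Comprec Lock Var Val Reg :=
  (Function.update C.1 r (some e), C.2)

open Classical in
/-- Keep only the register entries whose expression satisfies `p`; flush all others. -/
noncomputable def filterRegs (Φ : Regrec Var Val Reg) (p : Expr Var Val → Prop) :
    Regrec Var Val Reg :=
  fun r => (Φ r).filter (fun e => decide (p e))

open Classical in
/-- The entries on which two register records agree. -/
noncomputable def meetRegs (Φ Φ' : Regrec Var Val Reg) : Regrec Var Val Reg :=
  fun r => if Φ r = Φ' r then Φ r else none

/-- Expression compiler. `A` holds the registers in use, and `l` is the label for the first
instruction emitted. Returns the code, the register that holds the result, the final compilation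
record, and whether register allocation failed. -/
noncomputable def compileExpr [Inhabited Reg] (R : RegAlloc Var Val Reg) :
    Comprec Lock Var Val Reg → Set Reg → Option ℕ → Expr Var Val →
    AnnText Lock Var Val Reg × Reg × Comprec Lock Var Val Reg × Bool
  | C, A, l, Expr.const n =>
    match R.alloc C.1 A with
    | some r => ([((l, Instr.moveK r n), C)], r, recordReg C r (Expr.const n), false)
    | none => ([], default, C, true)
  | C, A, l, Expr.var v =>
    match R.allocCached C.1 A v with
    | some r => ([], r, C, false)
    | none =>
      match R.alloc C.1 A with
      | some r => ([((l, Instr.load r v), C)], r, recordReg C r (Expr.var v), false)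
      | none => ([], default, C, true)
  | C, A, l, Expr.op f e₁ e₂ =>
    let (P₁, r₁, C₁, fail₁) := compileExpr R C A l e₁
    let l₁ := if P₁.isEmpty then l else none
    let (P₂, r₂, C₂, fail₂) := compileExpr R C₁ (insert r₁ A) l₁ e₂
    let l₂ := if P₂.isEmpty then l₁ else none
    (P₁ ++ P₂ ++ [((l₂, Instr.op f r₁ r₂), C₂)], r₁,
      recordReg C₂ r₁ (Expr.op f e₁ e₂), fail₁ || fail₂)

/-- Code generation, after the static checks. `l` is the label for the first instruction emitted
and `nl` the next unused label. Returns the annotated code, the label to be attached to the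
instruction that follows, the next unused label, the final compilation record, and whether
compilation failed. -/
noncomputable def compileCmdAux [Inhabited Reg] (D : LockDiscipline Lock Var Val)
    (R : RegAlloc Var Val Reg) :
    Comprec Lock Var Val Reg → Option ℕ → ℕ → Cmd Lock Var Val →
    AnnText Lock Var Val Reg × Option ℕ × ℕ × Comprec Lock Var Val Reg × Bool
  | C, l, nl, Cmd.halt => ([], l, nl, C, true)
  | C, l, nl, Cmd.skip => ([((l, Instr.nop), C)], none, nl, C, false)
  | C, l, nl, Cmd.seq c₁ c₂ =>
    let (P₁, l₁, nl₁, C₁, fail₁) := compileCmdAux D R C l nl c₁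
    let (P₂, l₂, nl₂, C₂, fail₂) := compileCmdAux D R C₁ l₁ nl₁ c₂
    (P₁ ++ P₂, l₂, nl₂, C₂, fail₁ || fail₂)
  | C, l, nl, Cmd.ite e c₁ c₂ =>
    let (Pe, r, C₁, faile) := compileExpr R C ∅ l e
    let br := nl
    let ex := nl + 1
    let (P₁, l₁, nl₁, C₂, fail₁) := compileCmdAux D R C₁ none (nl + 2) c₁
    let (P₂, l₂, nl₂, C₃, fail₂) := compileCmdAux D R C₁ (some br) nl₁ c₂
    (Pe ++ [((if Pe.isEmpty then l else none, Instr.jz br r), C₁)] ++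
        P₁ ++ [((l₁, Instr.jmp ex), C₂)] ++ P₂ ++ [((l₂, Instr.nopEpilogue), C₃)],
      some ex, nl₂, (meetRegs C₂.1 C₃.1, C₂.2), faile || fail₁ || fail₂)
  | C, l, nl, Cmd.loop e c =>
    let (lp, nl') : ℕ × ℕ := match l with
      | some x => (x, nl)
      | none => (nl, nl + 1)
    let ex := nl'
    let (Pe, r, C₁, faile) := compileExpr R (fun _ => none, C.2) ∅ (some lp) e
    let (P, l₁, nl₁, C₂, fail₁) := compileCmdAux D R C₁ none (nl' + 1) c
    (Pe ++ [((if Pe.isEmpty then some lp else none, Instr.jz ex r), C₁)] ++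
        P ++ [((l₁, Instr.jmp lp), C₂)],
      some ex, nl₁, C₁, faile || fail₁)
  | C, l, nl, Cmd.assign v e =>
    let (Pe, r, C₁, faile) := compileExpr R C ∅ l e
    (Pe ++ [((if Pe.isEmpty then l else none, Instr.store v r), C₁)], none, nl,
      (filterRegs C₁.1 (fun e' => v ∉ e'.vars), C₁.2), faile)
  | C, l, nl, Cmd.lockAcq k =>
    ([((l, Instr.lockAcq k), C)], none, nl, (C.1, asmAcq D C.2 k), false)
  | C, l, nl, Cmd.lockRel k =>
    let S := asmRel D C.2 k
    ([((l, Instr.lockRel k), C)], none, nl, (filterRegs C.1 (ExprStable D S), S), false)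

open Classical in
/-- The compiler: code generation, with inputs that violate its requirements rejected. -/
noncomputable def compileCmd [Inhabited Reg] (D : LockDiscipline Lock Var Val)
    (R : RegAlloc Var Val Reg) (C : Comprec Lock Var Val Reg) (l : Option ℕ) (nl : ℕ)
    (c : Cmd Lock Var Val) :
    AnnText Lock Var Val Reg × Option ℕ × ℕ × Comprec Lock Var Val Reg × Bool :=
  let (PCs, l', nl', C', failed) := compileCmdAux D R C l nl c
  (PCs, l', nl', C', failed || decide (¬ CompilerInputReqs D C l nl c))

end Compiler

end CVDNI

/-! Two RISC runs of the whole system along one schedule are compared directly, by an invariant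
(`SystemInv`). A partial map `h` from locks to thread indices, common to both runs, tells who holds
which lock and determines every mode state (`heldMds`). In each thread the two runs are at the same
`pc` of the same text, with possibly different registers; behind them stands one While command,
related to itself by an admissible bisimulation on two memories (`ThreadInv`).

These memories are not the actual ones. A variable that another thread may exclusively read and
write can differ between the runs although it is Low and the mode state of the given thread calls it
readable. Such variables are overwritten by 0 (`mask`, `hiddenFrom`). The thread cannot tell: the
static checks let it read only program variables with an assumption, and write only those or
variables governed by no lock, so it touches nothing hidden. A control variable is governed by the
same locks as what it controls, so visible variables keep their classification (`dma_mask`).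

When a thread steps itself, `compileCmdAux_codeAt` places its code in the text with all labels
resolved, and `StepMatched.of_cmd` turns the RISC step into zero or more While steps made on both
memories. The bisimulation, determinism and the ban on high branching keep the While command common
to both sides, and with it the target of every conditional jump.

When another thread steps, closure under globally consistent changes carries the bisimulation over
(`ThreadInv.change`). Locking protects the variables with an assumption (`Effect.holders`). The
low-equality needed for the new memories is borrowed from the thread that stepped, wherever that
thread sees the variable (`LowEqModulo.of_step`); this covers variables unmasked by a release.

Finally, in a nonempty system each variable is visible to some thread, whose bisimulation yields the
required equality (`SystemInv.low_eq`), and determinism of RISC extends the result to every second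
run. -/

namespace CVDNI

/-! ## Placed code: what the compiler guarantees, with labels resolved -/

section Static

variable {Lock Var Val Reg : Type*}

/-- `C'` keeps part of the register entries of `C`. -/
def RecordLe (C' C : Comprec Lock Var Val Reg) : Prop :=
  C'.2 = C.2 ∧ ∀ r e, C'.1 r = some e → C.1 r = some e

theorem RecordLe.refl (C : Comprec Lock Var Val Reg) : RecordLe C C :=
  ⟨rfl, fun _ _ h => h⟩

/-- All variables of `e` carry an assumption. -/
def ExprAssumed (S : Asmrec Lock Var) (e : Expr Var Val) : Prop :=
  ∀ v ∈ e.vars, (Sum.inr v : Lock ⊕ Var) ∈ S.1 ∪ S.2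

theorem ExprStable.assumed {D : LockDiscipline Lock Var Val} {S : Asmrec Lock Var}
    {e : Expr Var Val} (h : ExprStable D S e) : ExprAssumed S e :=
  fun v hv => (h v hv).1

/-- Straight-line code from `p` to `q` that evaluates expressions, with the records before and
after. -/
inductive StraightLine (P : List (LInstr Lock Var Val Reg)) :
    ℕ → Comprec Lock Var Val Reg → ℕ → Comprec Lock Var Val Reg → Prop where
  | nil (p C) : StraightLine P p C p C
  | load {p C q C' lab r v} (hI : P[p]? = some (lab, Instr.load r v))
      (hv : Sum.inr v ∈ C.2.1 ∪ C.2.2)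
      (h : StraightLine P (p + 1) (recordReg C r (Expr.var v)) q C') : StraightLine P p C q C'
  | moveK {p C q C' lab r n} (hI : P[p]? = some (lab, Instr.moveK r n))
      (h : StraightLine P (p + 1) (recordReg C r (Expr.const n)) q C') : StraightLine P p C q C'
  | op {p C q C' lab f r₁ r₂ e₁ e₂} (hI : P[p]? = some (lab, Instr.op f r₁ r₂))
      (h₁ : C.1 r₁ = some e₁) (h₂ : C.1 r₂ = some e₂)
      (he : ExprAssumed C.2 (Expr.op f e₁ e₂))
      (h : StraightLine P (p + 1) (recordReg C r₁ (Expr.op f e₁ e₂)) q C') :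
      StraightLine P p C q C'

theorem StraightLine.trans {P : List (LInstr Lock Var Val Reg)} {p C q C' s C''}
    (h : StraightLine P p C q C') (h' : StraightLine P q C' s C'') : StraightLine P p C s C'' := by
  induction h with
  | nil => exact h'
  | load hI hv _ ih => exact .load hI hv (ih h')
  | moveK hI _ ih => exact .moveK hI (ih h')
  | op hI h₁ h₂ he _ ih => exact .op hI h₁ h₂ he (ih h')

theorem StraightLine.snd_eq {P : List (LInstr Lock Var Val Reg)} {p C q C'}
    (h : StraightLine P p C q C') : C'.2 = C.2 := by
  induction h with
  | nil => rfl
  | load _ _ _ ih => exact ih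
  | moveK _ _ ih => exact ih
  | op _ _ _ _ _ ih => exact ih

/-- The code for `c` lies in `P` from `p` to `q`, with record `C` before and `C'` after it. The
code for the expression of a conditional or loop may have been executed in part. -/
def CodeAt (D : LockDiscipline Lock Var Val) (P : List (LInstr Lock Var Val Reg)) :
    Cmd Lock Var Val → Comprec Lock Var Val Reg → ℕ → ℕ → Comprec Lock Var Val Reg → Prop
  | Cmd.halt, _, _, _, _ => False
  | Cmd.skip, C, p, q, C' => (∃ lab, P[p]? = some (lab, Instr.nop)) ∧ q = p + 1 ∧ C' = C
  | Cmd.seq c₁ c₂, C, p, q, C' => ∃ m C₁, CodeAt D P c₁ C p m C₁ ∧ CodeAt D P c₂ C₁ m q C'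
  | Cmd.ite e c₁ c₂, C, p, q, C' => ∃ pe r C₁ lab br,
      StraightLine P p C pe C₁ ∧ C₁.1 r = some e ∧ P[pe]? = some (lab, Instr.jz br r) ∧
      (∃ p₁ C₂ lab₁ ex, CodeAt D P c₁ C₁ (pe + 1) p₁ C₂ ∧ P[p₁]? = some (lab₁, Instr.jmp ex) ∧
        resolveLabel P ex = q ∧ RecordLe C' C₂) ∧
      ∃ p₂ C₃ lab₂, CodeAt D P c₂ C₁ (resolveLabel P br) p₂ C₃ ∧
        P[p₂]? = some (lab₂, Instr.nopEpilogue) ∧ q = p₂ + 1 ∧ RecordLe C' C₃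
  -- `p` is the current position, possibly inside the code for the condition, while `p₀` is the loop
  -- head, where the back edge lands with no register entries. `C₀` allows for the flush on entry.
  | Cmd.loop e c, C, p, q, C' => ∃ p₀ pe r C₀ lab ex p₁ C₂ lab₁ lp,
      RecordLe C₀ C ∧ StraightLine P p C₀ pe C' ∧
      StraightLine P p₀ (fun _ => none, C.2) pe C' ∧ C'.1 r = some e ∧
      P[pe]? = some (lab, Instr.jz ex r) ∧ resolveLabel P ex = q ∧
      CodeAt D P c C' (pe + 1) p₁ C₂ ∧ C₂.2 = C'.2 ∧
      P[p₁]? = some (lab₁, Instr.jmp lp) ∧ resolveLabel P lp = p₀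
  | Cmd.assign v e, C, p, q, C' => ∃ pe r C₁ lab,
      StraightLine P p C pe C₁ ∧ C₁.1 r = some e ∧ P[pe]? = some (lab, Instr.store v r) ∧
      q = pe + 1 ∧ RecordLe C' C₁ ∧ (∀ r' e', C'.1 r' = some e' → v ∉ e'.vars) ∧
      (Sum.inr v ∈ C.2.1 ∪ C.2.2 ∨ ¬ D.LockGoverned v)
  | Cmd.lockAcq k, C, p, q, C' => (∃ lab, P[p]? = some (lab, Instr.lockAcq k)) ∧ q = p + 1 ∧
      C' = (C.1, asmAcq D C.2 k)
  | Cmd.lockRel k, C, p, q, C' => (∃ lab, P[p]? = some (lab, Instr.lockRel k)) ∧ q = p + 1 ∧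
      C'.2 = asmRel D C.2 k ∧
      ∀ r e, C'.1 r = some e → C.1 r = some e ∧ ExprAssumed C'.2 e

theorem recordReg_self (C : Comprec Lock Var Val Reg) (r : Reg) (e : Expr Var Val) :
    (recordReg C r e).1 r = some e := by simp [recordReg]

theorem recordReg_of_ne (C : Comprec Lock Var Val Reg) {r r' : Reg} (h : r' ≠ r)
    (e : Expr Var Val) : (recordReg C r e).1 r' = C.1 r' := by simp [recordReg, h]

/-- Links the records of placed code to the static checks, which are phrased with `asmAfter`. -/
theorem CodeAt.snd_eq {D : LockDiscipline Lock Var Val} {P : List (LInstr Lock Var Val Reg)}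
    (c : Cmd Lock Var Val) :
    ∀ {C : Comprec Lock Var Val Reg} {p q C'}, CodeAt D P c C p q C' →
      C'.2 = asmAfter D c C.2 := by
  induction c with
  | halt => exact fun h => h.elim
  | skip => rintro C p q C' ⟨-, -, rfl⟩; rfl
  | lockAcq k => rintro C p q C' ⟨-, -, rfl⟩; rfl
  | lockRel k => rintro C p q C' ⟨-, -, h, -⟩; exact h
  | assign v e =>
    rintro C p q C' ⟨pe, r, C₁, lab, hs, -, -, -, hle, -⟩
    exact hle.1.trans hs.snd_eq
  | seq c₁ c₂ ih₁ ih₂ =>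
    rintro C p q C' ⟨m, C₁, h₁, h₂⟩
    rw [ih₂ h₂, ih₁ h₁]; rfl
  | ite e c₁ c₂ ih₁ ih₂ =>
    rintro C p q C' ⟨pe, r, C₁, lab, br, hs, -, -, ⟨p₁, C₂, lab₁, ex, h₁, -, -, hle⟩, -⟩
    rw [hle.1, ih₁ h₁, hs.snd_eq]; rfl
  | loop e c ih =>
    rintro C p q C' ⟨p₀, pe, r, C₀, lab, ex, p₁, C₂, lab₁, lp, hle, hs, -⟩
    rw [hs.snd_eq, hle.1]; rfl

theorem filterRegs_eq_some {Φ : Regrec Var Val Reg} {p : Expr Var Val → Prop} {r e}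
    (h : filterRegs Φ p r = some e) : Φ r = some e ∧ p e := by
  simpa [filterRegs, Option.filter_eq_some_iff] using h

theorem meetRegs_eq_some {Φ Φ' : Regrec Var Val Reg} {r e}
    (h : meetRegs Φ Φ' r = some e) : Φ r = some e ∧ Φ' r = some e := by
  unfold meetRegs at h
  split_ifs at h with h'
  exact ⟨h, h' ▸ h⟩

theorem getElem?_of_eq_append_cons {α : Type*} {P L M : List α} {a : α} {n : ℕ}
    (hP : P = L ++ a :: M) (hn : n = L.length) : P[n]? = some a := by
  subst hP hn; simp

/-- With `post` empty the search fails and returns the end of the text, which is again the length of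
`pre`; this is why only `post.head?` is constrained. -/
theorem resolveLabel_of_eq_append {P pre post : List (LInstr Lock Var Val Reg)} {l n : ℕ}
    (hP : P = pre ++ post) (hn : n = pre.length) (hpre : ∀ J ∈ pre, J.1 ≠ some l)
    (hpost : ∀ J ∈ post.head?, J.1 = some l) : resolveLabel P l = n := by
  subst hP hn
  have h : pre.findIdx (fun I => I.1 == some l) = pre.length :=
    List.findIdx_eq_length.2 fun J hJ => by simpa using hpre J hJ
  rw [resolveLabel, List.findIdx_append, h, if_neg (lt_irrefl _)]
  cases post with
  | nil => simp
  | cons J L => simp [List.findIdx_cons, hpost J rfl]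

/-! ### Register and label discipline of the generated code -/

variable [Inhabited Reg]

/-- Entries of registers in use survive because no emitted instruction targets a register of `A`.
Only the first instruction can carry a label, so no jump lands in the middle of an expression. -/
theorem compileExpr_spec {R : RegAlloc Var Val Reg} (hR : R.Correct) (e : Expr Var Val) :
    ∀ {C : Comprec Lock Var Val Reg} {A l Pe r C₁},
      compileExpr R C A l e = (Pe, r, C₁, false) →
      r ∉ A ∧ C₁.1 r = some e ∧ C₁.2 = C.2 ∧ (∀ a ∈ A, C₁.1 a = C.1 a) ∧
      (Pe = [] ∨ ∃ I Ca L, Pe = ((l, I), Ca) :: L ∧ ∀ J ∈ L, J.1.1 = none) := by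
  induction e with
  | const n =>
    intro C A l Pe r C₁ h
    cases ha : R.alloc C.1 A with
    | none => simp [compileExpr, ha] at h
    | some r' =>
      simp only [compileExpr, ha, Prod.mk.injEq] at h
      obtain ⟨rfl, rfl, rfl, -⟩ := h
      have hr := hR.alloc_notMem _ _ _ ha
      exact ⟨hr, recordReg_self .., rfl,
        fun a haA => recordReg_of_ne _ (ne_of_mem_of_not_mem haA hr) _, .inr ⟨_, _, _, rfl, by simp⟩⟩
  | var v =>
    intro C A l Pe r C₁ h
    cases hc : R.allocCached C.1 A v with
    | some r' =>
      simp only [compileExpr, hc, Prod.mk.injEq] at h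
      obtain ⟨rfl, rfl, rfl, -⟩ := h
      exact ⟨hR.allocCached_notMem _ _ _ _ hc, hR.allocCached_contains _ _ _ _ hc, rfl,
        fun _ _ => rfl, .inl rfl⟩
    | none =>
      cases ha : R.alloc C.1 A with
      | none => simp [compileExpr, ha, hc] at h
      | some r' =>
        simp only [compileExpr, ha, hc, Prod.mk.injEq] at h
        obtain ⟨rfl, rfl, rfl, -⟩ := h
        have hr := hR.alloc_notMem _ _ _ ha
        exact ⟨hr, recordReg_self .., rfl,
          fun a haA => recordReg_of_ne _ (ne_of_mem_of_not_mem haA hr) _, .inr ⟨_, _, _, rfl, by simp⟩⟩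
  | op f e₁ e₂ ih₁ ih₂ =>
    intro C A l Pe r C₁ h
    rcases h₁ : compileExpr R C A l e₁ with ⟨P₁, r₁, C', f₁⟩
    rcases h₂ : compileExpr R C' (insert r₁ A) (if P₁.isEmpty then l else none) e₂
      with ⟨P₂, r₂, C'', f₂⟩
    simp only [compileExpr, h₁, h₂, Prod.mk.injEq, Bool.or_eq_false_iff] at h
    obtain ⟨rfl, rfl, rfl, rfl, rfl⟩ := h
    obtain ⟨hr₁, -, hS₁, hA₁, hl₁⟩ := ih₁ h₁
    obtain ⟨-, -, hS₂, hA₂, hl₂⟩ := ih₂ h₂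
    refine ⟨hr₁, recordReg_self .., hS₂.trans hS₁, fun a ha => ?_, .inr ?_⟩
    · rw [recordReg_of_ne _ (ne_of_mem_of_not_mem ha hr₁), hA₂ a (Set.mem_insert_of_mem _ ha), hA₁ a ha]
    · rcases hl₁ with rfl | ⟨I, Ca, L, rfl, hL⟩
      · rcases hl₂ with rfl | ⟨I, Ca, L, rfl, hL⟩
        · exact ⟨_, _, _, rfl, by simp⟩
        · refine ⟨I, Ca, L ++ [((none, Instr.op f r₁ r₂), C'')], by simp, ?_⟩
          simp only [List.mem_append, List.mem_singleton]
          rintro J (hJ | rfl)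
          exacts [hL J hJ, rfl]
      · refine ⟨I, Ca, L ++ P₂ ++ [((none, Instr.op f r₁ r₂), C'')], by simp, ?_⟩
        simp only [List.mem_append, List.mem_singleton]
        rintro J ((hJ | hJ) | rfl)
        · exact hL J hJ
        · rcases hl₂ with rfl | ⟨I, Ca, L, rfl, hL'⟩
          · simp at hJ
          · rcases List.mem_cons.1 hJ with rfl | hJ
            exacts [rfl, hL' J hJ]
        · rfl

theorem compileExpr_straightLine {R : RegAlloc Var Val Reg} (hR : R.Correct)
    {P : List (LInstr Lock Var Val Reg)} (e : Expr Var Val) :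
    ∀ {C : Comprec Lock Var Val Reg} {A l Pe r C₁} (pre post : List (LInstr Lock Var Val Reg)),
      compileExpr R C A l e = (Pe, r, C₁, false) → ExprAssumed C.2 e →
      P = pre ++ Pe.map Prod.fst ++ post →
      StraightLine P pre.length C (pre.length + Pe.length) C₁ := by
  induction e with
  | const n =>
    intro C A l Pe r C₁ pre post h he hP
    cases ha : R.alloc C.1 A with
    | none => simp [compileExpr, ha] at h
    | some r' =>
      simp only [compileExpr, ha, Prod.mk.injEq] at h
      obtain ⟨rfl, rfl, rfl, -⟩ := h
      exact .moveK (lab := l) (by simp [hP]) (.nil _ _)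
  | var v =>
    intro C A l Pe r C₁ pre post h he hP
    cases hc : R.allocCached C.1 A v with
    | some r' =>
      simp only [compileExpr, hc, Prod.mk.injEq] at h
      obtain ⟨rfl, rfl, rfl, -⟩ := h
      exact .nil _ _
    | none =>
      cases ha : R.alloc C.1 A with
      | none => simp [compileExpr, ha, hc] at h
      | some r' =>
        simp only [compileExpr, ha, hc, Prod.mk.injEq] at h
        obtain ⟨rfl, rfl, rfl, -⟩ := h
        exact .load (lab := l) (by simp [hP]) (he v (by simp [Expr.vars])) (.nil _ _)
  | op f e₁ e₂ ih₁ ih₂ =>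
    intro C A l Pe r C₁ pre post h he hP
    rcases h₁ : compileExpr R C A l e₁ with ⟨P₁, r₁, C', f₁⟩
    rcases h₂ : compileExpr R C' (insert r₁ A) (if P₁.isEmpty then l else none) e₂
      with ⟨P₂, r₂, C'', f₂⟩
    simp only [compileExpr, h₁, h₂, Prod.mk.injEq, Bool.or_eq_false_iff] at h
    obtain ⟨rfl, rfl, rfl, rfl, rfl⟩ := h
    obtain ⟨hr₁, hv₁, hS₁, hA₁, hl₁⟩ := compileExpr_spec hR _ h₁
    obtain ⟨-, hv₂, hS₂, hA₂, hl₂⟩ := compileExpr_spec hR _ h₂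
    generalize (if P₂.isEmpty then (if P₁.isEmpty then l else none) else none) = l₂ at *
    have s₁ := ih₁ pre (P₂.map Prod.fst ++ (l₂, Instr.op f r₁ r₂) :: post) h₁
      (fun v hv => he v (Or.inl hv)) (by simp [hP])
    have s₂ := ih₂ (pre ++ P₁.map Prod.fst) ((l₂, Instr.op f r₁ r₂) :: post) h₂
      (fun v hv => hS₁ ▸ he v (Or.inr hv)) (by simp [hP])
    rw [List.length_append, List.length_map] at s₂
    -- The code for `e₂` was compiled with `r₁` marked as in use, so `r₁` is still recorded as
    -- holding `e₁`.
    refine s₁.trans (s₂.trans (.op (f := f) (r₁ := r₁) (r₂ := r₂) (lab := l₂) ?_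
      ((hA₂ r₁ (Set.mem_insert _ _)).trans hv₁) hv₂ (by rw [hS₂, hS₁]; exact he) ?_))
    · exact getElem?_of_eq_append_cons (L := pre ++ P₁.map Prod.fst ++ P₂.map Prod.fst) (M := post)
        (by simp [hP]) (by simp; omega)
    · have : pre.length + (P₁ ++ P₂ ++ [((l₂, Instr.op f r₁ r₂), C'')]).length =
        pre.length + P₁.length + P₂.length + 1 := by simp; omega
      rw [this]
      exact .nil _ _

/-- A cached variable produces no code; the label then passes to the instruction `I` that uses the
result. -/
theorem compileExpr_cons_labels {R : RegAlloc Var Val Reg} (hR : R.Correct) {e : Expr Var Val}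
    {C : Comprec Lock Var Val Reg} {A l Pe r C₁}
    (h : compileExpr R C A l e = (Pe, r, C₁, false)) (I : Instr Lock Var Val Reg) :
    ∃ I' L, Pe.map Prod.fst ++ [(if Pe.isEmpty then l else none, I)] = (l, I') :: L ∧
      ∀ J ∈ L, J.1 = none := by
  rcases (compileExpr_spec hR e h).2.2.2.2 with rfl | ⟨I', Ca, L, rfl, hL⟩
  · exact ⟨I, [], by simp, by simp⟩
  · refine ⟨I', L.map Prod.fst ++ [(none, I)], by simp, ?_⟩
    simp only [List.mem_append, List.mem_singleton, List.mem_map]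
    rintro J (⟨J, hJ, rfl⟩ | rfl)
    exacts [hL J hJ, rfl]

/-- Freshness: each subcommand draws its labels from its own interval of the counter. The outgoing
label does not occur in the code it leaves, so it can only resolve to what follows. -/
theorem compileCmdAux_labels {D : LockDiscipline Lock Var Val} {R : RegAlloc Var Val Reg}
    (hR : R.Correct) (c : Cmd Lock Var Val) :
    ∀ {C : Comprec Lock Var Val Reg} {l nl PCs l' nl' C'},
      compileCmdAux D R C l nl c = (PCs, l', nl', C', false) → (∀ x, l = some x → x < nl) →
      nl ≤ nl' ∧ (∀ y, l' = some y → nl ≤ y ∧ y < nl') ∧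
      (∀ x, l = some x → ∃ I L, PCs.map Prod.fst = (some x, I) :: L) ∧
      ∀ J ∈ PCs.map Prod.fst, ∀ y, J.1 = some y →
        l = some y ∨ (nl ≤ y ∧ y < nl' ∧ l' ≠ some y) := by
  induction c with
  | halt => simp [compileCmdAux]
  | skip =>
    intro C l nl PCs l' nl' C' h hl
    simp only [compileCmdAux, Prod.mk.injEq] at h
    obtain ⟨rfl, rfl, rfl, rfl, -⟩ := h
    simpa using fun _ => Or.inl
  | lockAcq k =>
    intro C l nl PCs l' nl' C' h hl
    simp only [compileCmdAux, Prod.mk.injEq] at h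
    obtain ⟨rfl, rfl, rfl, rfl, -⟩ := h
    simpa using fun _ => Or.inl
  | lockRel k =>
    intro C l nl PCs l' nl' C' h hl
    simp only [compileCmdAux, Prod.mk.injEq] at h
    obtain ⟨rfl, rfl, rfl, rfl, -⟩ := h
    simpa using fun _ => Or.inl
  | assign v e =>
    intro C l nl PCs l' nl' C' h hl
    rcases he : compileExpr R C ∅ l e with ⟨Pe, r, C₁, f₁⟩
    simp only [compileCmdAux, he, Prod.mk.injEq] at h
    obtain ⟨rfl, rfl, rfl, rfl, rfl⟩ := h
    obtain ⟨I, L, hL, hn⟩ := compileExpr_cons_labels hR he (.store v r)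
    simp only [List.map_append, List.map_cons, List.map_nil, hL]
    refine ⟨le_rfl, by simp, fun x hx => ⟨I, L, by rw [hx]⟩, fun J hJ y hy => ?_⟩
    rcases List.mem_cons.1 hJ with rfl | hJ
    · exact .inl hy
    · simp [hn J hJ] at hy
  | seq c₁ c₂ ih₁ ih₂ =>
    intro C l nl PCs l' nl' C' h hl
    rcases h₁ : compileCmdAux D R C l nl c₁ with ⟨P₁, l₁, nl₁, C₁, f₁⟩
    rcases h₂ : compileCmdAux D R C₁ l₁ nl₁ c₂ with ⟨P₂, l₂, nl₂, C₂, f₂⟩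
    simp only [compileCmdAux, h₁, h₂, Prod.mk.injEq, Bool.or_eq_false_iff] at h
    obtain ⟨rfl, rfl, rfl, rfl, rfl, rfl⟩ := h
    obtain ⟨a₁, b₁, d₁, g₁⟩ := ih₁ h₁ hl
    obtain ⟨a₂, b₂, d₂, g₂⟩ := ih₂ h₂ (fun x hx => (b₁ x hx).2)
    refine ⟨a₁.trans a₂, fun y hy => ⟨a₁.trans (b₂ y hy).1, (b₂ y hy).2⟩, fun x hx => ?_,
      fun J hJ y hy => ?_⟩
    · obtain ⟨I, L, hL⟩ := d₁ x hx
      exact ⟨I, L ++ P₂.map Prod.fst, by simp [hL]⟩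
    · rw [List.map_append, List.mem_append] at hJ
      rcases hJ with hJ | hJ
      · rcases g₁ J hJ y hy with h | h
        · exact .inl h
        · exact .inr ⟨h.1, h.2.1.trans_le a₂, fun h' => by have := (b₂ y h').1; omega⟩
      · rcases g₂ J hJ y hy with h | h
        · have := b₁ y h
          exact .inr ⟨this.1, this.2.trans_le a₂, fun h' => by have := (b₂ y h').1; omega⟩
        · exact .inr ⟨a₁.trans h.1, h.2⟩
  | ite e c₁ c₂ ih₁ ih₂ =>
    intro C l nl PCs l' nl' C' h hl
    rcases he : compileExpr R C ∅ l e with ⟨Pe, r, C₁, fe⟩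
    rcases h₁ : compileCmdAux D R C₁ none (nl + 2) c₁ with ⟨P₁, l₁, nl₁, C₂, f₁⟩
    rcases h₂ : compileCmdAux D R C₁ (some nl) nl₁ c₂ with ⟨P₂, l₂, nl₂, C₃, f₂⟩
    simp only [compileCmdAux, he, h₁, h₂, Prod.mk.injEq, Bool.or_eq_false_iff] at h
    obtain ⟨rfl, rfl, rfl, rfl, ⟨rfl, rfl⟩, rfl⟩ := h
    obtain ⟨a₁, b₁, -, g₁⟩ := ih₁ h₁ (by simp)
    obtain ⟨a₂, b₂, -, g₂⟩ := ih₂ h₂ (by rintro x ⟨⟩; omega)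
    obtain ⟨I, L, hL, hn⟩ := compileExpr_cons_labels hR he (.jz nl r)
    simp only [List.map_append, List.map_cons, List.map_nil, hL]
    refine ⟨by omega, by rintro y ⟨⟩; omega, fun x hx => ⟨I, _, by rw [hx]; rfl⟩,
      fun J hJ y hy => ?_⟩
    simp only [List.mem_append, List.mem_cons, List.not_mem_nil, or_false] at hJ
    simp only [ne_eq, Option.some.injEq]
    rcases hJ with (((((rfl | hJ) | hJ) | rfl) | hJ) | rfl)
    · exact .inl hy
    · simp [hn J hJ] at hy
    · rcases g₁ J hJ y hy with h | h
      · simp at h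
      · omega
    · have := b₁ y hy; omega
    · rcases g₂ J hJ y hy with h | h
      · simp only [Option.some.injEq] at h; omega
      · omega
    · have := b₂ y hy; omega
  | loop e c ih =>
    -- The head label `lp` is the incoming label or a fresh one; both cases need only `lp < ex`.
    have key : ∀ {C : Comprec Lock Var Val Reg} {lp ex Pe r C₁ fe P l₁ nl₁ C₂ f₁ lab jm},
        compileExpr R C ∅ (some lp) e = (Pe, r, C₁, fe) →
        compileCmdAux D R C₁ none (ex + 1) c = (P, l₁, nl₁, C₂, f₁) → (fe || f₁) = false →
        lp < ex → lab = (if Pe.isEmpty then some lp else none) →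
        ex ≤ nl₁ ∧ ex < nl₁ ∧
        (∃ I L, (Pe ++ [((lab, Instr.jz ex r), C₁)] ++ P ++ [((l₁, jm), C₂)]).map Prod.fst
          = (some lp, I) :: L) ∧
        ∀ J ∈ (Pe ++ [((lab, Instr.jz ex r), C₁)] ++ P ++ [((l₁, jm), C₂)]).map Prod.fst,
          ∀ y, J.1 = some y → y = lp ∨ (ex < y ∧ y < nl₁) := by
      intro C lp ex Pe r C₁ fe P l₁ nl₁ C₂ f₁ lab jm he h₁ hf hlp hlab
      obtain ⟨rfl, rfl⟩ := Bool.or_eq_false_iff.1 hf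
      subst hlab
      obtain ⟨a₁, b₁, -, g₁⟩ := ih h₁ (by simp)
      obtain ⟨I, L, hL, hn⟩ := compileExpr_cons_labels hR he (.jz ex r)
      simp only [List.map_append, List.map_cons, List.map_nil, hL]
      refine ⟨by omega, by omega, ⟨I, _, rfl⟩, fun J hJ y hy => ?_⟩
      simp only [List.mem_append, List.mem_cons, List.not_mem_nil, or_false] at hJ
      rcases hJ with (((rfl | hJ) | hJ) | rfl)
      · exact .inl (by simpa using hy.symm)
      · simp [hn J hJ] at hy
      · rcases g₁ J hJ y hy with h | h
        · simp at h
        · omega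
      · have := b₁ y hy; omega
    intro C l nl PCs l' nl' C' h hl
    cases l with
    | none =>
      rcases he : compileExpr R (fun _ => none, C.2) ∅ (some nl) e with ⟨Pe, r, C₁, fe⟩
      rcases h₁ : compileCmdAux D R C₁ none (nl + 1 + 1) c with ⟨P₁, l₁, nl₁, C₂, f₁⟩
      simp only [compileCmdAux, he, h₁, Prod.mk.injEq] at h
      obtain ⟨rfl, rfl, rfl, rfl, hf⟩ := h
      obtain ⟨k₁, k₂, -, k₃⟩ := key (jm := Instr.jmp nl) he h₁ hf (by omega) rfl
      refine ⟨by omega, by rintro y ⟨⟩; omega, by simp, fun J hJ y hy => .inr ?_⟩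
      have := k₃ J hJ y hy
      simp only [ne_eq, Option.some.injEq]
      omega
    | some x =>
      have hx := hl x rfl
      rcases he : compileExpr R (fun _ => none, C.2) ∅ (some x) e with ⟨Pe, r, C₁, fe⟩
      rcases h₁ : compileCmdAux D R C₁ none (nl + 1) c with ⟨P₁, l₁, nl₁, C₂, f₁⟩
      simp only [compileCmdAux, he, h₁, Prod.mk.injEq] at h
      obtain ⟨rfl, rfl, rfl, rfl, hf⟩ := h
      obtain ⟨k₁, k₂, k₄, k₃⟩ := key (jm := Instr.jmp x) he h₁ hf (by omega) rfl
      refine ⟨by omega, by rintro y ⟨⟩; omega, by rintro y ⟨⟩; exact k₄, fun J hJ y hy => ?_⟩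
      have := k₃ J hJ y hy
      simp only [ne_eq, Option.some.injEq]
      omega

end Static

/-! ### Compiled commands as placed code -/

section Placement

variable {Lock Var Val Reg : Type*} [Inhabited Reg]

/-- The induction runs over a fixed full text, since labels are resolved in it and not in fragments.
The condition on `pre` prevents an earlier instruction from capturing a label of this fragment, and
the one on `post` places the outgoing label right after the code. -/
theorem compileCmdAux_codeAt {D : LockDiscipline Lock Var Val} {R : RegAlloc Var Val Reg}
    (hR : R.Correct) {P : List (LInstr Lock Var Val Reg)} (c : Cmd Lock Var Val) :
    ∀ {C : Comprec Lock Var Val Reg} {l nl PCs l' nl' C' n q} (pre post),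
      compileCmdAux D R C l nl c = (PCs, l', nl', C', false) → (∀ x, l = some x → x < nl) →
      StabilityChecksAux D c C.2 → P = pre ++ PCs.map Prod.fst ++ post → n = pre.length →
      q = n + PCs.length →
      (∀ J ∈ pre, ∀ y, J.1 = some y → l ≠ some y ∧ ¬ (nl ≤ y ∧ y < nl')) →
      (∀ y, l' = some y → ∀ J ∈ post.head?, J.1 = some y) → CodeAt D P c C n q C' := by
  induction c with
  | halt => simp [compileCmdAux]
  | skip =>
    intro C l nl PCs l' nl' C' n q pre post h hl hs hP hn hq hpre hpost
    simp only [compileCmdAux, Prod.mk.injEq] at h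
    obtain ⟨rfl, rfl, rfl, rfl, -⟩ := h
    exact ⟨⟨l, getElem?_of_eq_append_cons (M := post) (by simpa using hP) hn⟩, hq, rfl⟩
  | lockAcq k =>
    intro C l nl PCs l' nl' C' n q pre post h hl hs hP hn hq hpre hpost
    simp only [compileCmdAux, Prod.mk.injEq] at h
    obtain ⟨rfl, rfl, rfl, rfl, -⟩ := h
    exact ⟨⟨l, getElem?_of_eq_append_cons (M := post) (by simpa using hP) hn⟩, hq, rfl⟩
  | lockRel k =>
    intro C l nl PCs l' nl' C' n q pre post h hl hs hP hn hq hpre hpost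
    simp only [compileCmdAux, Prod.mk.injEq] at h
    obtain ⟨rfl, rfl, rfl, rfl, -⟩ := h
    refine ⟨⟨l, getElem?_of_eq_append_cons (M := post) (by simpa using hP) hn⟩, hq, rfl,
      fun r e h => ?_⟩
    obtain ⟨h₁, h₂⟩ := filterRegs_eq_some h
    exact ⟨h₁, h₂.assumed⟩
  | assign v e =>
    intro C l nl PCs l' nl' C' n q pre post h hl hs hP hn hq hpre hpost
    rcases he : compileExpr R C ∅ l e with ⟨Pe, r, C₁, f₁⟩
    simp only [compileCmdAux, he, Prod.mk.injEq] at h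
    obtain ⟨rfl, rfl, rfl, rfl, rfl⟩ := h
    generalize (if Pe.isEmpty then l else none) = lab at *
    refine ⟨n + Pe.length, r, C₁, lab, ?_, (compileExpr_spec hR e he).2.1,
      getElem?_of_eq_append_cons (L := pre ++ Pe.map Prod.fst) (M := post)
        (by simpa using hP) (by simp [hn]), by simpa [add_assoc] using hq,
      ⟨rfl, fun r e h => (filterRegs_eq_some h).1⟩, fun r e h => (filterRegs_eq_some h).2, ?_⟩
    · rw [hn]
      exact compileExpr_straightLine hR e pre ((lab, Instr.store v r) :: post) he hs.1.assumed
        (by simpa using hP)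
    · by_cases hv : VarStable D C.2 (Sum.inr v)
      · exact .inl hv.1
      · exact .inr (hs.2 hv)
  | seq c₁ c₂ ih₁ ih₂ =>
    intro C l nl PCs l' nl' C' n q pre post h hl hs hP hn hq hpre hpost
    rcases h₁ : compileCmdAux D R C l nl c₁ with ⟨P₁, l₁, nl₁, C₁, f₁⟩
    rcases h₂ : compileCmdAux D R C₁ l₁ nl₁ c₂ with ⟨P₂, l₂, nl₂, C₂, f₂⟩
    simp only [compileCmdAux, h₁, h₂, Prod.mk.injEq, Bool.or_eq_false_iff] at h
    obtain ⟨rfl, rfl, rfl, rfl, rfl, rfl⟩ := h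
    obtain ⟨a₁, b₁, -, g₁⟩ := compileCmdAux_labels hR _ h₁ hl
    have hl₁ : ∀ x, l₁ = some x → x < nl₁ := fun x hx => (b₁ x hx).2
    obtain ⟨a₂, b₂, d₂, -⟩ := compileCmdAux_labels hR _ h₂ hl₁
    have k₁ : CodeAt D P c₁ C n (n + P₁.length) C₁ := by
      refine ih₁ pre (P₂.map Prod.fst ++ post) h₁ hl hs.1 (by simpa using hP) hn rfl ?_ ?_
      · intro J hJ y hy
        have := hpre J hJ y hy
        exact ⟨this.1, by omega⟩
      · intro y hy
        obtain ⟨I, L, hL⟩ := d₂ y hy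
        simp [hL]
    refine ⟨_, C₁, k₁, ih₂ (pre ++ P₁.map Prod.fst) post h₂ hl₁ ?_ (by simpa using hP)
      (by simp [hn]) (by simp [hq]; omega) ?_ hpost⟩
    · rw [k₁.snd_eq]; exact hs.2
    · intro J hJ y hy
      rcases List.mem_append.1 hJ with hJ | hJ
      · have := hpre J hJ y hy
        refine ⟨fun h => ?_, by omega⟩
        have := b₁ y h
        omega
      · rcases g₁ J hJ y hy with h | h
        · have := hl y h
          refine ⟨fun h => ?_, by omega⟩
          have := b₁ y h
          omega
        · exact ⟨h.2.2, by omega⟩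
  | ite e c₁ c₂ ih₁ ih₂ =>
    intro C l nl PCs l' nl' C' n q pre post h hl hs hP hn hq hpre hpost
    obtain ⟨hs₀, hs₁, hs₂, hs₃⟩ := hs
    rcases he : compileExpr R C ∅ l e with ⟨Pe, r, C₁, fe⟩
    rcases h₁ : compileCmdAux D R C₁ none (nl + 2) c₁ with ⟨P₁, l₁, nl₁, C₂, f₁⟩
    rcases h₂ : compileCmdAux D R C₁ (some nl) nl₁ c₂ with ⟨P₂, l₂, nl₂, C₃, f₂⟩
    simp only [compileCmdAux, he, h₁, h₂, Prod.mk.injEq, Bool.or_eq_false_iff] at h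
    obtain ⟨rfl, rfl, rfl, rfl, ⟨rfl, rfl⟩, rfl⟩ := h
    obtain ⟨a₁, b₁, -, g₁⟩ := compileCmdAux_labels hR _ h₁ (by simp)
    have hl₂ : ∀ x, some nl = some x → x < nl₁ := by rintro x ⟨⟩; omega
    obtain ⟨a₂, b₂, d₂, g₂⟩ := compileCmdAux_labels hR _ h₂ hl₂
    obtain ⟨I, L, hL, hn'⟩ := compileExpr_cons_labels hR he (.jz nl r)
    generalize (if Pe.isEmpty then l else none) = lab at *
    have hS : C₁.2 = C.2 := (compileExpr_spec hR e he).2.2.1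
    have hE : ∀ J ∈ Pe.map Prod.fst ++ [(lab, Instr.jz nl r)], ∀ y, J.1 = some y → y < nl := by
      intro J hJ y hy
      rw [hL] at hJ
      rcases List.mem_cons.1 hJ with rfl | hJ
      · exact hl y hy
      · simp [hn' J hJ] at hy
    generalize hEe : Pe.map Prod.fst ++ [(lab, Instr.jz nl r)] = E at *
    have hElen : E.length = Pe.length + 1 := by simp [← hEe]
    have hP' : P = pre ++ E ++ P₁.map Prod.fst ++ (l₁, Instr.jmp (nl + 1)) ::
        (P₂.map Prod.fst ++ (l₂, Instr.nopEpilogue) :: post) := by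
      rw [hP, ← hEe]; simp
    have k₁ : CodeAt D P c₁ C₁ (n + Pe.length + 1) (n + Pe.length + 1 + P₁.length) C₂ := by
      refine ih₁ (pre ++ E) _ h₁ (by simp) (hS ▸ hs₁) hP' (by simp [hn, hElen]; omega) rfl ?_ ?_
      · intro J hJ y hy
        refine ⟨by simp, ?_⟩
        rcases List.mem_append.1 hJ with hJ | hJ
        · have := hpre J hJ y hy; omega
        · have := hE J hJ y hy; omega
      · simp +contextual
    -- Nothing before the second branch carries `nl`, `nl + 1` or a label of that branch, so the
    -- search for `nl` stops at its first instruction.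
    have hpre₂ : ∀ J ∈ pre ++ E ++ P₁.map Prod.fst ++ [(l₁, Instr.jmp (nl + 1))],
        ∀ y, J.1 = some y → y ≠ nl ∧ y ≠ nl + 1 ∧ ¬ (nl₁ ≤ y ∧ y < nl₂) := by
      intro J hJ y hy
      simp only [List.mem_append, List.mem_cons, List.not_mem_nil, or_false] at hJ
      rcases hJ with (((hJ | hJ) | hJ) | rfl)
      · have := hpre J hJ y hy; omega
      · have := hE J hJ y hy; omega
      · rcases g₁ J hJ y hy with h | h
        · simp at h
        · omega
      · have := b₁ y hy; omega
    have hbr : resolveLabel P nl = n + Pe.length + 1 + P₁.length + 1 := by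
      refine resolveLabel_of_eq_append (pre := pre ++ E ++ P₁.map Prod.fst ++
        [(l₁, Instr.jmp (nl + 1))]) (post := P₂.map Prod.fst ++ (l₂, Instr.nopEpilogue) :: post)
        (by rw [hP']; simp) (by simp [hn, hElen]; omega) (fun J hJ h => (hpre₂ J hJ _ h).1 rfl) ?_
      obtain ⟨I, L, hL⟩ := d₂ nl rfl
      simp [hL]
    have hex : resolveLabel P (nl + 1) = q := by
      refine resolveLabel_of_eq_append (pre := (pre ++ E ++ P₁.map Prod.fst ++
        [(l₁, Instr.jmp (nl + 1))]) ++ P₂.map Prod.fst ++ [(l₂, Instr.nopEpilogue)]) (post := post)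
        (by rw [hP']; simp) (by simp [hq, hn, hElen]; omega) (fun J hJ h => ?_) (hpost _ rfl)
      rw [List.mem_append, List.mem_append] at hJ
      rcases hJ with ((hJ | hJ) | hJ)
      · exact (hpre₂ J hJ _ h).2.1 rfl
      · rcases g₂ J hJ _ h with h | h
        · simp at h
        · omega
      · rw [List.mem_singleton.1 hJ] at h
        have := b₂ _ h; omega
    have k₂ : CodeAt D P c₂ C₁ (n + Pe.length + 1 + P₁.length + 1)
        (n + Pe.length + 1 + P₁.length + 1 + P₂.length) C₃ := by
      refine ih₂ (pre ++ E ++ P₁.map Prod.fst ++ [(l₁, Instr.jmp (nl + 1))])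
        ((l₂, Instr.nopEpilogue) :: post) h₂ hl₂ (hS ▸ hs₂) (by rw [hP']; simp)
        (by simp [hn, hElen]; omega) rfl (fun J hJ y hy => ?_) (by simp +contextual)
      have := hpre₂ J hJ y hy
      exact ⟨by simpa using this.1.symm, this.2.2⟩
    refine ⟨n + Pe.length, r, C₁, lab, nl, ?_, (compileExpr_spec hR e he).2.1,
      getElem?_of_eq_append_cons (L := pre ++ Pe.map Prod.fst) (by rw [hP', ← hEe]; simp; rfl)
        (by simp [hn]), ⟨_, C₂, l₁, nl + 1, k₁,
      getElem?_of_eq_append_cons hP' (by simp [hn, hElen]; omega), hex, rfl,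
      fun r e h => (meetRegs_eq_some h).1⟩,
      n + Pe.length + 1 + P₁.length + 1 + P₂.length, C₃, l₂, ?_, ?_, by simp [hq]; omega, ?_⟩
    · rw [hn]
      exact compileExpr_straightLine hR e pre _ he hs₀.assumed (by rw [hP', ← hEe]; simp; rfl)
    · rwa [hbr]
    · exact getElem?_of_eq_append_cons (L := pre ++ E ++ P₁.map Prod.fst ++
        [(l₁, Instr.jmp (nl + 1))] ++ P₂.map Prod.fst) (M := post) (by rw [hP']; simp)
        (by simp [hn, hElen]; omega)
    · exact ⟨by rw [k₁.snd_eq, k₂.snd_eq, hS, hs₃], fun r e h => (meetRegs_eq_some h).2⟩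
  | loop e c ih =>
    have key : ∀ {C : Comprec Lock Var Val Reg} {lp ex Pe r C₁ fe PCs P₁ l₁ nl₁ C₂ f₁ lab n q}
        (pre post),
        compileExpr R (fun _ => none, C.2) ∅ (some lp) e = (Pe, r, C₁, fe) →
        compileCmdAux D R C₁ none (ex + 1) c = (P₁, l₁, nl₁, C₂, f₁) → (fe || f₁) = false →
        lp < ex → lab = (if Pe.isEmpty then some lp else none) →
        PCs = Pe ++ [((lab, Instr.jz ex r), C₁)] ++ P₁ ++ [((l₁, Instr.jmp lp), C₂)] →
        StabilityChecksAux D (Cmd.loop e c) C.2 → P = pre ++ PCs.map Prod.fst ++ post →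
        n = pre.length → q = n + PCs.length →
        (∀ J ∈ pre, ∀ y, J.1 = some y → lp ≠ y ∧ ¬ (ex ≤ y ∧ y < nl₁)) →
        (∀ J ∈ post.head?, J.1 = some ex) → CodeAt D P (Cmd.loop e c) C n q C₁ := by
      intro C lp ex Pe r C₁ fe PCs P₁ l₁ nl₁ C₂ f₁ lab n q pre post he h₁ hf hlp hlab hPC hs hP hn
        hq hpre hpost
      obtain ⟨rfl, rfl⟩ := Bool.or_eq_false_iff.1 hf
      obtain ⟨hs₀, hs₁, hs₂⟩ := hs
      obtain ⟨a₁, b₁, -, g₁⟩ := compileCmdAux_labels hR _ h₁ (by simp)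
      obtain ⟨I, L, hL, hn'⟩ := compileExpr_cons_labels hR he (.jz ex r)
      rw [← hlab] at hL
      have hS : C₁.2 = C.2 := (compileExpr_spec hR e he).2.2.1
      generalize hEe : Pe.map Prod.fst ++ [(lab, Instr.jz ex r)] = E at *
      have hE : ∀ J ∈ E, ∀ y, J.1 = some y → y = lp := by
        intro J hJ y hy
        rw [hL] at hJ
        rcases List.mem_cons.1 hJ with rfl | hJ
        · simpa using hy.symm
        · simp [hn' J hJ] at hy
      have hElen : E.length = Pe.length + 1 := by simp [← hEe]
      have hP' : P = pre ++ E ++ P₁.map Prod.fst ++ (l₁, Instr.jmp lp) :: post := by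
        rw [hP, ← hEe, hPC]; simp
      have hstr : StraightLine P n (fun _ => none, C.2) (n + Pe.length) C₁ := by
        rw [hn]
        exact compileExpr_straightLine hR e pre _ he hs₀.assumed (by rw [hP', ← hEe]; simp; rfl)
      have k₁ : CodeAt D P c C₁ (n + Pe.length + 1) (n + Pe.length + 1 + P₁.length) C₂ := by
        refine ih (pre ++ E) _ h₁ (by simp) (hS ▸ hs₁) hP' (by simp [hn, hElen]; omega) rfl ?_ ?_
        · intro J hJ y hy
          refine ⟨by simp, ?_⟩
          rcases List.mem_append.1 hJ with hJ | hJ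
          · have := hpre J hJ y hy; omega
          · have := hE J hJ y hy; omega
        · simp +contextual
      refine ⟨n, n + Pe.length, r, (fun _ => none, C.2), lab, ex, _, C₂, l₁, lp, ⟨rfl, by simp⟩, hstr, hstr,
        (compileExpr_spec hR e he).2.1,
        getElem?_of_eq_append_cons (L := pre ++ Pe.map Prod.fst) (by rw [hP', ← hEe]; simp; rfl)
        (by simp [hn]), ?_, k₁, by rw [k₁.snd_eq, hS, hs₂],
        getElem?_of_eq_append_cons hP' (by simp [hn, hElen]; omega), ?_⟩
      · refine resolveLabel_of_eq_append (pre := pre ++ E ++ P₁.map Prod.fst ++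
          [(l₁, Instr.jmp lp)]) (post := post) (by rw [hP']; simp)
          (by simp [hq, hn, hPC, hElen]; omega) (fun J hJ h => ?_) hpost
        simp only [List.mem_append, List.mem_cons, List.not_mem_nil, or_false] at hJ
        rcases hJ with (((hJ | hJ) | hJ) | rfl)
        · have := hpre J hJ _ h; omega
        · have := hE J hJ _ h; omega
        · rcases g₁ J hJ _ h with h | h
          · simp at h
          · omega
        · have := b₁ _ h; omega
      · exact resolveLabel_of_eq_append (pre := pre)
          (post := E ++ P₁.map Prod.fst ++ (l₁, Instr.jmp lp) :: post) (by rw [hP']; simp) hn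
          (fun J hJ h => (hpre J hJ _ h).1 rfl) (by simp [hL])
    intro C l nl PCs l' nl' C' n q pre post h hl hs hP hn hq hpre hpost
    cases l with
    | none =>
      rcases he : compileExpr R (fun _ => none, C.2) ∅ (some nl) e with ⟨Pe, r, C₁, fe⟩
      rcases h₁ : compileCmdAux D R C₁ none (nl + 1 + 1) c with ⟨P₁, l₁, nl₁, C₂, f₁⟩
      simp only [compileCmdAux, he, h₁, Prod.mk.injEq] at h
      obtain ⟨hPC, rfl, rfl, rfl, hf⟩ := h
      -- Puts the fresh head label `nl` inside the interval that `pre` avoids.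
      have : nl + 1 + 1 ≤ nl₁ := by
        rw [(Bool.or_eq_false_iff.1 hf).2] at h₁
        exact (compileCmdAux_labels hR c h₁ (by simp)).1
      refine key pre post he h₁ hf (by omega) rfl hPC.symm hs hP hn hq (fun J hJ y hy => ?_)
        (hpost _ rfl)
      have := hpre J hJ y hy
      omega
    | some x =>
      have hx := hl x rfl
      rcases he : compileExpr R (fun _ => none, C.2) ∅ (some x) e with ⟨Pe, r, C₁, fe⟩
      rcases h₁ : compileCmdAux D R C₁ none (nl + 1) c with ⟨P₁, l₁, nl₁, C₂, f₁⟩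
      simp only [compileCmdAux, he, h₁, Prod.mk.injEq] at h
      obtain ⟨hPC, rfl, rfl, rfl, hf⟩ := h
      refine key pre post he h₁ hf (by omega) rfl hPC.symm hs hP hn hq (fun J hJ y hy => ?_)
        (hpost _ rfl)
      have := hpre J hJ y hy
      simp only [ne_eq, Option.some.injEq] at this
      omega

end Placement

/-! ## One thread: two RISC runs follow two related While runs -/

section Local

variable {Lock Var Val Reg : Type*}

/-- `c` followed by the commands in the list. -/
def Cmd.fill : Cmd Lock Var Val → List (Cmd Lock Var Val) → Cmd Lock Var Val
  | c, [] => c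
  | c, d :: K => (Cmd.seq c d).fill K

/-- The While state for a list of pending commands, in which a leading `halt` has already been
stepped away. -/
def Cmd.start : List (Cmd Lock Var Val) → Cmd Lock Var Val
  | [] => Cmd.halt
  | c :: K => c.fill K

theorem Cmd.leftmost_fill (K : List (Cmd Lock Var Val)) :
    ∀ c : Cmd Lock Var Val, (c.fill K).leftmost = c.leftmost := by
  induction K with
  | nil => exact fun _ => rfl
  | cons d K ih => exact fun c => ih _

theorem Expr.eval_congr {m m' : Mem (Lock ⊕ Var) Val} (e : Expr Var Val)
    (h : ∀ v ∈ e.vars, m (Sum.inr v) = m' (Sum.inr v)) : e.eval m = e.eval m' := by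
  induction e with
  | const n => rfl
  | var v => exact h v rfl
  | op f e₁ e₂ ih₁ ih₂ =>
    simp only [Expr.eval]
    rw [ih₁ fun v hv => h v (.inl hv), ih₂ fun v hv => h v (.inr hv)]

/-- The registers hold the values recorded, of expressions over variables with assumptions. -/
def RecordOk (C : Comprec Lock Var Val Reg) (regs : Reg → Val) (m : Mem (Lock ⊕ Var) Val) :
    Prop :=
  ∀ r e, C.1 r = some e → ExprAssumed C.2 e ∧ regs r = e.eval m

theorem RecordOk.mono {C C' : Comprec Lock Var Val Reg} {regs : Reg → Val}
    {m : Mem (Lock ⊕ Var) Val} (h : RecordOk C regs m) (hle : RecordLe C' C) :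
    RecordOk C' regs m :=
  fun r e he => ⟨hle.1 ▸ (h r e (hle.2 r e he)).1, (h r e (hle.2 r e he)).2⟩

theorem RecordOk.recordReg [DecidableEq Reg] {C : Comprec Lock Var Val Reg} {regs : Reg → Val}
    {m : Mem (Lock ⊕ Var) Val} (h : RecordOk C regs m) (r : Reg) {e : Expr Var Val}
    (he : ExprAssumed C.2 e) {a : Val} (ha : a = e.eval m) :
    RecordOk (recordReg C r e) (Function.update regs r a) m := by
  intro r' e' h'
  by_cases hr : r' = r
  · subst hr
    rw [recordReg_self, Option.some.injEq] at h'
    subst h'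
    exact ⟨he, by simp [ha]⟩
  · rw [recordReg_of_ne _ hr] at h'
    rw [Function.update_of_ne hr]
    exact h r' e' h'

/-- From `p`, with record `C`, the program executes the commands in the list and stops. -/
inductive Continues (D : LockDiscipline Lock Var Val) (P : List (LInstr Lock Var Val Reg)) :
    ℕ → Comprec Lock Var Val Reg → List (Cmd Lock Var Val) → Prop where
  | nil (C) : Continues D P P.length C []
  | cmd {c p C q C' K} (hc : CodeAt D P c C p q C') (h : Continues D P q C' K) :
      Continues D P p C (c :: K)
  | jmp {p lab l C C' K} (hI : P[p]? = some (lab, Instr.jmp l)) (hC : RecordLe C' C)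
      (h : Continues D P (resolveLabel P l) C' K) : Continues D P p C K
  | epilogue {p lab C C' K} (hI : P[p]? = some (lab, Instr.nopEpilogue)) (hC : RecordLe C' C)
      (h : Continues D P (p + 1) C' K) : Continues D P p C K

variable [Zero Val] {D : LockDiscipline Lock Var Val}

theorem EvalW.fill (K : List (Cmd Lock Var Val)) :
    ∀ {c mds m c' mds' m'}, EvalW D ((c, mds), m) ((c', mds'), m') →
      EvalW D ((c.fill K, mds), m) ((c'.fill K, mds'), m') := by
  induction K with
  | nil => exact fun h => h
  | cons d K ih => exact fun h => ih (.seq _ _ _ _ _ _ _ h)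

/-- A bisimulation only promises some matching step; determinism identifies it with the step that
the compiled code follows. -/
theorem EvalW.deterministic (c : Cmd Lock Var Val) :
    ∀ {mds m lc lc'}, EvalW D ((c, mds), m) lc → EvalW D ((c, mds), m) lc' → lc = lc' := by
  induction c with
  | seq c₁ c₂ ih _ =>
    intro mds m lc lc' h h'
    cases h with
    | seq _ _ _ _ c' mds' m' h =>
      cases h' with
      | seq _ _ _ _ c'' mds'' m'' h' =>
        have := ih h h'
        simp only [Prod.mk.injEq] at this
        obtain ⟨⟨rfl, rfl⟩, rfl⟩ := this
        rfl
      | seqHalt => cases h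
    | seqHalt =>
      cases h' with
      | seq _ _ _ _ c'' mds'' m'' h' => cases h'
      | seqHalt => rfl
  | _ => intro mds m lc lc' h h'; cases h <;> cases h' <;> first | rfl | contradiction

theorem EvalR.deterministic {lc lc' lc'' : LocalConf (RiscTps Lock Var Val Reg) (Lock ⊕ Var) Val}
    (h : EvalR D lc lc') (h' : EvalR D lc lc'') : lc' = lc'' := by
  cases h <;> cases h' <;> simp_all

/-- Some admissible bisimulation relates the While command `c` on `m₁` to `c` on `m₂`. -/
def Related (D : LockDiscipline Lock Var Val) (mds : Mds (Lock ⊕ Var)) (c : Cmd Lock Var Val)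
    (m₁ m₂ : Mem (Lock ⊕ Var) Val) : Prop :=
  ∃ B, StrongLowBisimMM D.dma (EvalW D) B ∧ NoHighBranching B ∧ B ((c, mds), m₁) ((c, mds), m₂)

namespace Related

variable {mds mds' mds'' : Mds (Lock ⊕ Var)} {c c' c'' : Cmd Lock Var Val}
  {m₁ m₂ m₁' m₂' : Mem (Lock ⊕ Var) Val}

/-- `NoHighBranching` forces the two resulting commands to coincide, so a single command continues
to describe both runs. -/
theorem step (h : Related D mds c m₁ m₂) (h₁ : EvalW D ((c, mds), m₁) ((c', mds'), m₁'))
    (h₂ : EvalW D ((c, mds), m₂) ((c'', mds''), m₂')) : Related D mds' c' m₁' m₂' := by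
  obtain ⟨B, hB, hN, hc⟩ := h
  obtain ⟨lc, hlc, hm, hc'⟩ := (hB.2.2 _ _ hc rfl).2 _ h₁
  obtain rfl := EvalW.deterministic _ hlc h₂
  obtain rfl : mds' = mds'' := hm
  obtain rfl : c' = c'' := (hN _ _ _ _ _ hc').1
  exact ⟨B, hB, hN, hc'⟩

theorem eval_eq (h : Related D mds c m₁ m₂) {e c₁ c₂} (hc : c.leftmost = Cmd.ite e c₁ c₂) :
    e.eval m₁ = e.eval m₂ := by
  obtain ⟨B, hB, hN, hc'⟩ := h
  exact (hN _ _ _ _ _ hc').2 _ _ _ hc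

theorem lowEqModulo (h : Related D mds c m₁ m₂) : LowEqModulo D.dma mds m₁ m₂ := by
  obtain ⟨B, hB, hN, hc⟩ := h
  exact (hB.2.2 _ _ hc rfl).1

theorem change (h : Related D mds c m₁ m₂)
    (hw : ∀ x, (m₁ x ≠ m₁' x ∨ m₂ x ≠ m₂' x ∨ D.dma m₁ x ≠ D.dma m₁' x) → Writable mds x)
    (hl : LowEqModulo D.dma mds m₁' m₂') : Related D mds c m₁' m₂' := by
  obtain ⟨B, hB, hN, hc⟩ := h
  exact ⟨B, hB, hN, hB.1 _ _ _ _ _ hc _ _ hw hl⟩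

theorem start {K : List (Cmd Lock Var Val)} (h : Related D mds (Cmd.halt.fill K) m₁ m₂) :
    Related D mds (Cmd.start K) m₁ m₂ := by
  cases K with
  | nil => exact h
  | cons d K => exact h.step (.fill K (.seqHalt ..)) (.fill K (.seqHalt ..))

end Related

open Classical in
/-- The memory in which the variables of `N` are hidden. -/
noncomputable def mask {X : Type*} (N : Set X) (mem : Mem X Val) : Mem X Val :=
  fun x => if x ∈ N then 0 else mem x

theorem mask_of_notMem {X : Type*} {N : Set X} {x : X} (h : x ∉ N) (mem : Mem X Val) :
    mask N mem x = mem x := if_neg h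

theorem mask_of_mem {X : Type*} {N : Set X} {x : X} (h : x ∈ N) (mem : Mem X Val) :
    mask N mem x = 0 := if_pos h

theorem mask_update {X : Type*} [DecidableEq X] {N : Set X} {x : X} (h : x ∉ N) (mem : Mem X Val)
    (a : Val) : mask N (Function.update mem x a) = Function.update (mask N mem) x a := by
  funext y
  by_cases hy : y = x
  · subst hy; simp [mask, h]
  · simp [mask, hy]

/-- Two RISC states at `pc` that differ in registers follow related While commands. -/
def ThreadInv (D : LockDiscipline Lock Var Val) (P : List (LInstr Lock Var Val Reg)) (pc : ℕ)
    (regs₁ regs₂ : Reg → Val) (mds : Mds (Lock ⊕ Var)) (m₁ m₂ : Mem (Lock ⊕ Var) Val) : Prop :=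
  ∃ K C, Related D mds (Cmd.start K) m₁ m₂ ∧ Continues D P pc C K ∧
    C.2 = (mds Mode.asmNoW, mds Mode.asmNoRW) ∧ RecordOk C regs₁ m₁ ∧ RecordOk C regs₂ m₂

open Classical in
/-- The ways in which a step of a thread can change two memories and the mode state. -/
inductive Effect (D : LockDiscipline Lock Var Val) (mds : Mds (Lock ⊕ Var))
    (mem₁ mem₂ : Mem (Lock ⊕ Var) Val) :
    Mds (Lock ⊕ Var) → Mem (Lock ⊕ Var) Val → Mem (Lock ⊕ Var) Val → Prop where
  | silent : Effect D mds mem₁ mem₂ mds mem₁ mem₂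
  | write (v a b)
      (h : Sum.inr v ∈ mds Mode.asmNoW ∪ mds Mode.asmNoRW ∨ ¬ D.LockGoverned v) :
      Effect D mds mem₁ mem₂ mds (Function.update mem₁ (Sum.inr v) a)
        (Function.update mem₂ (Sum.inr v) b)
  | acquire (k) (h : ¬ D.evLock (mem₁ (Sum.inl k))) :
      Effect D mds mem₁ mem₂ (D.lockAcqUpd mds k) (Function.update mem₁ (Sum.inl k) D.lockTrue)
        (Function.update mem₂ (Sum.inl k) D.lockTrue)
  | release (k) (h : D.LockHeldMdsCorrect mds k) :
      Effect D mds mem₁ mem₂ (D.lockRelUpd mds k) (Function.update mem₁ (Sum.inl k) D.lockFalse)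
        (Function.update mem₂ (Sum.inl k) D.lockFalse)

/-- The step to `lc` is matched by a step from registers `regs₂` and memory `mem₂`. -/
def StepMatched (D : LockDiscipline Lock Var Val) (N : Set (Lock ⊕ Var))
    (P : List (LInstr Lock Var Val Reg)) (pc : ℕ) (regs₂ : Reg → Val) (mds : Mds (Lock ⊕ Var))
    (mem₁ mem₂ : Mem (Lock ⊕ Var) Val)
    (lc : LocalConf (RiscTps Lock Var Val Reg) (Lock ⊕ Var) Val) : Prop :=
  ∃ pc' regs₁' regs₂' mds' mem₁' mem₂', lc = ((((pc', P), regs₁'), mds'), mem₁') ∧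
    EvalR D ((((pc, P), regs₂), mds), mem₂) ((((pc', P), regs₂'), mds'), mem₂') ∧
    ThreadInv D P pc' regs₁' regs₂' mds' (mask N mem₁') (mask N mem₂') ∧
    Effect D mds mem₁ mem₂ mds' mem₁' mem₂'

variable {N : Set (Lock ⊕ Var)} {P : List (LInstr Lock Var Val Reg)} {pc : ℕ}
  {regs₁ regs₂ : Reg → Val} {mds : Mds (Lock ⊕ Var)} {mem₁ mem₂ : Mem (Lock ⊕ Var) Val}
  {lc : LocalConf (RiscTps Lock Var Val Reg) (Lock ⊕ Var) Val}

/-- A step of straight-line code. -/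
theorem StraightLine.step {C C₁ : Comprec Lock Var Val Reg} {pe : ℕ}
    (h : StraightLine P pc C pe C₁) (mds : Mds (Lock ⊕ Var))
    (hN : ∀ x ∈ C.2.1 ∪ C.2.2, x ∉ N) :
    (pc = pe ∧ C = C₁) ∨ ∃ C', C'.2 = C.2 ∧ StraightLine P (pc + 1) C' pe C₁ ∧
      ∀ regs mem, RecordOk C regs (mask N mem) →
        ∃ regs', RecordOk C' regs' (mask N mem) ∧
          EvalR D ((((pc, P), regs), mds), mem) ((((pc + 1, P), regs'), mds), mem) := by
  classical
  cases h with
  | nil => exact .inl ⟨rfl, rfl⟩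
  | @load _ _ _ _ _ r v hI hv h =>
    refine .inr ⟨recordReg C r (.var v), rfl, h, fun regs mem hC =>
      ⟨_, hC.recordReg r ?_ ?_, .load _ _ _ _ _ _ _ _ hI⟩⟩
    · rintro w rfl; exact hv
    · exact (mask_of_notMem (hN _ hv) _).symm
  | @moveK _ _ _ _ _ r n hI h =>
    exact .inr ⟨recordReg C r (.const n), rfl, h, fun regs mem hC =>
      ⟨_, hC.recordReg r (e := .const n) (fun w hw => (Set.notMem_empty w hw).elim) rfl,
        .moveK _ _ _ _ _ _ _ _ hI⟩⟩
  | @op _ _ _ _ _ f r₁ r₂ e₁ e₂ hI h₁ h₂ he h =>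
    refine .inr ⟨recordReg C r₁ (.op f e₁ e₂), rfl, h, fun regs mem hC =>
      ⟨_, hC.recordReg r₁ he ?_, .op _ _ _ _ _ _ _ _ _ hI⟩⟩
    rw [(hC _ _ h₁).2, (hC _ _ h₂).2]; rfl

/-- The case of a RISC step that changes registers only: the While command does not move. -/
theorem StepMatched.of_continues {C C' : Comprec Lock Var Val Reg} {K}
    (hs : EvalR D ((((pc, P), regs₁), mds), mem₁) lc)
    (hr : Related D mds (Cmd.start K) (mask N mem₁) (mask N mem₂)) (hS : C'.2 = C.2)
    (hC : C.2 = (mds Mode.asmNoW, mds Mode.asmNoRW))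
    (h₁ : RecordOk C regs₁ (mask N mem₁)) (h₂ : RecordOk C regs₂ (mask N mem₂))
    (hK : Continues D P (pc + 1) C' K)
    (h : ∀ regs mem, RecordOk C regs (mask N mem) → ∃ regs', RecordOk C' regs' (mask N mem) ∧
      EvalR D ((((pc, P), regs), mds), mem) ((((pc + 1, P), regs'), mds), mem)) :
    StepMatched D N P pc regs₂ mds mem₁ mem₂ lc := by
  obtain ⟨regs₁', h₁', hs₁⟩ := h _ _ h₁
  obtain ⟨regs₂', h₂', hs₂⟩ := h _ _ h₂
  exact ⟨_, _, _, _, _, _, hs.deterministic hs₁, hs₂,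
    ⟨K, C', hr, hK, hS.trans hC, h₁', h₂'⟩, .silent⟩

end Local

/-! ### One RISC step of a thread, matched in the other run -/

section Local

variable {Lock Var Val Reg : Type*} {D : LockDiscipline Lock Var Val}
  {N : Set (Lock ⊕ Var)} {P : List (LInstr Lock Var Val Reg)} {pc : ℕ}
  {regs₁ regs₂ : Reg → Val} {mds : Mds (Lock ⊕ Var)} {mem₁ mem₂ : Mem (Lock ⊕ Var) Val}
  {lc : LocalConf (RiscTps Lock Var Val Reg) (Lock ⊕ Var) Val}

/-- The variables of `N` are governed by locks and carry no assumption in `mds`. -/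
def Hidden (D : LockDiscipline Lock Var Val) (mds : Mds (Lock ⊕ Var)) (N : Set (Lock ⊕ Var)) :
    Prop :=
  ∀ x ∈ N, (∃ v, x = Sum.inr v ∧ D.LockGoverned v) ∧ x ∉ mds Mode.asmNoW ∪ mds Mode.asmNoRW

theorem Hidden.lock_notMem (h : Hidden D mds N) (k : Lock) : Sum.inl k ∉ N := fun hk => by
  obtain ⟨⟨v, hv, -⟩, -⟩ := h _ hk
  cases hv

theorem RecordOk.change {C C' : Comprec Lock Var Val Reg} {regs : Reg → Val}
    {m m' : Mem (Lock ⊕ Var) Val} (h : RecordOk C regs m)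
    (h' : ∀ r e, C'.1 r = some e → C.1 r = some e ∧ (ExprAssumed C.2 e → ExprAssumed C'.2 e) ∧
      ∀ v ∈ e.vars, m (Sum.inr v) = m' (Sum.inr v)) : RecordOk C' regs m' := fun r e he => by
  obtain ⟨h₁, h₂, h₃⟩ := h' r e he
  exact ⟨h₂ (h r e h₁).1, (h r e h₁).2.trans (e.eval_congr h₃)⟩

variable [Zero Val]

/-- Induction on the command only serves to reach the leftmost one: in a sequence the second part is
pushed onto `K`. The masked memories drive the While side and the actual ones the RISC side; they
agree on everything the step reads or writes. -/
theorem StepMatched.of_cmd (hD : D.WellFormed) (hN : Hidden D mds N)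
    (hL : ∀ k, Sum.inl k ∉ mds Mode.asmNoRW)
    (hs : EvalR D ((((pc, P), regs₁), mds), mem₁) lc) (c : Cmd Lock Var Val) :
    ∀ {C q C' K}, CodeAt D P c C pc q C' → Continues D P q C' K →
      Related D mds (c.fill K) (mask N mem₁) (mask N mem₂) →
      C.2 = (mds Mode.asmNoW, mds Mode.asmNoRW) → RecordOk C regs₁ (mask N mem₁) →
      RecordOk C regs₂ (mask N mem₂) → StepMatched D N P pc regs₂ mds mem₁ mem₂ lc := by
  classical
  have hstr : ∀ {C : Comprec Lock Var Val Reg} {pe C₁},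
      C.2 = (mds Mode.asmNoW, mds Mode.asmNoRW) → StraightLine P pc C pe C₁ →
      (pc = pe ∧ C = C₁) ∨ ∃ C', C'.2 = C.2 ∧ StraightLine P (pc + 1) C' pe C₁ ∧
      ∀ regs mem, RecordOk C regs (mask N mem) →
        ∃ regs', RecordOk C' regs' (mask N mem) ∧
          EvalR D ((((pc, P), regs), mds), mem) ((((pc + 1, P), regs'), mds), mem) := by
    intro C pe C₁ hC h
    refine h.step mds fun x hx hxN => (hN x hxN).2 ?_
    rwa [hC] at hx
  -- Locks are Low, readable and never masked, so an acquisition succeeds in both runs or spins in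
  -- both.
  have hlock : ∀ {c' : Cmd Lock Var Val} (k : Lock),
      Related D mds c' (mask N mem₁) (mask N mem₂) → mem₁ (Sum.inl k) = mem₂ (Sum.inl k) := by
    intro c' k h
    have := h.lowEqModulo (Sum.inl k) (.inr ⟨hD.lock_low _ _, hL k⟩)
    rwa [mask_of_notMem (hN.lock_notMem k), mask_of_notMem (hN.lock_notMem k)] at this
  induction c with
  | halt => exact fun h => h.elim
  | skip =>
    rintro C q C' K ⟨⟨lab, hI⟩, rfl, rfl⟩ hK hr hC h₁ h₂
    exact ⟨_, _, _, _, _, _, hs.deterministic (.nop _ _ _ _ _ _ hI), .nop _ _ _ _ _ _ hI,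
      ⟨K, C', (hr.step (.fill K (.skip ..)) (.fill K (.skip ..))).start, hK, hC, h₁, h₂⟩, .silent⟩
  | lockAcq k =>
    rintro C q C' K ⟨⟨lab, hI⟩, rfl, rfl⟩ hK hr hC h₁ h₂
    have hk := hlock k hr
    have hm : ∀ mem : Mem (Lock ⊕ Var) Val, mask N mem (Sum.inl k) = mem (Sum.inl k) :=
      mask_of_notMem (hN.lock_notMem k)
    by_cases hev : D.evLock (mem₁ (Sum.inl k))
    · exact ⟨_, _, _, _, _, _, hs.deterministic (.lockSpin _ _ _ _ _ _ _ hI hev),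
        .lockSpin _ _ _ _ _ _ _ hI (hk ▸ hev),
        ⟨Cmd.lockAcq k :: K, C, hr, .cmd (c := Cmd.lockAcq k) ⟨⟨lab, hI⟩, rfl, rfl⟩ hK, hC, h₁, h₂⟩, .silent⟩
    · refine ⟨_, _, _, _, _, _, hs.deterministic (.lockAcq _ _ _ _ _ _ _ hI hev),
        .lockAcq _ _ _ _ _ _ _ hI (hk ▸ hev),
        ⟨K, _, ?_, hK, ?_, ?_, ?_⟩, .acquire k hev⟩
      · rw [mask_update (hN.lock_notMem k), mask_update (hN.lock_notMem k)]
        exact (hr.step (.fill K (.lockAcq k _ _ (by rwa [hm])))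
          (.fill K (.lockAcq k _ _ (by rwa [hm, ← hk])))).start
      · rw [hC]; rfl
      · exact h₁.change fun r e he =>
          ⟨he, fun h v hv => Or.imp Or.inl Or.inl (h v hv), fun v _ => by simp [mask]⟩
      · exact h₂.change fun r e he =>
          ⟨he, fun h v hv => Or.imp Or.inl Or.inl (h v hv), fun v _ => by simp [mask]⟩
  | lockRel k =>
    rintro C q C' K ⟨⟨lab, hI⟩, rfl, hS, hC'⟩ hK hr hC h₁ h₂
    by_cases hev : D.LockHeldMdsCorrect mds k
    · refine ⟨_, _, _, _, _, _, hs.deterministic (.lockRel _ _ _ _ _ _ _ hI hev),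
        .lockRel _ _ _ _ _ _ _ hI hev,
        ⟨K, _, ?_, hK, ?_, ?_, ?_⟩, .release k hev⟩
      · rw [mask_update (hN.lock_notMem k), mask_update (hN.lock_notMem k)]
        exact (hr.step (.fill K (.lockRel k _ _ hev)) (.fill K (.lockRel k _ _ hev))).start
      · rw [hS, hC]; rfl
      · exact h₁.change fun r e he =>
          ⟨(hC' r e he).1, fun _ => (hC' r e he).2, fun v _ => by simp [mask]⟩
      · exact h₂.change fun r e he =>
          ⟨(hC' r e he).1, fun _ => (hC' r e he).2, fun v _ => by simp [mask]⟩
    · exact ⟨_, _, _, _, _, _, hs.deterministic (.lockInvalid _ _ _ _ _ _ _ hI hev),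
        .lockInvalid _ _ _ _ _ _ _ hI hev,
        ⟨Cmd.lockRel k :: K, C, hr, .cmd (c := Cmd.lockRel k) ⟨⟨lab, hI⟩, rfl, hS, hC'⟩ hK, hC, h₁, h₂⟩, .silent⟩
  | assign v e =>
    rintro C q C' K ⟨pe, r, C₁, lab, hst, hr₁, hI, rfl, hle, hv, hg⟩ hK hr hC h₁ h₂
    rcases hstr hC hst with ⟨rfl, rfl⟩ | ⟨C₂, hS, hst', hev⟩
    -- The assigned variable has an assumption or no governing lock; hidden variables have a
    -- governing lock and no assumption. Hence the write commutes with masking.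
    · have hvN : Sum.inr v ∉ N := fun h => by
        rw [hC] at hg
        rcases hg with hg | hg
        · exact (hN _ h).2 hg
        · obtain ⟨⟨w, hw, hg'⟩, -⟩ := hN _ h
          cases hw
          exact hg hg'
      refine ⟨_, _, _, _, _, _, hs.deterministic (.store _ _ _ _ _ _ _ _ hI),
        .store _ _ _ _ _ _ _ _ hI, ⟨K, _, ?_, hK, hle.1.trans hC, ?_, ?_⟩,
        .write v _ _ (by rwa [hC] at hg)⟩
      · rw [mask_update hvN, mask_update hvN, (h₁ _ _ hr₁).2, (h₂ _ _ hr₁).2]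
        exact (hr.step (.fill K (.assign ..)) (.fill K (.assign ..))).start
      -- Entries that mention `v` were flushed, so the remaining ones do not notice the write.
      all_goals
        have hne : ∀ {r' e'}, C'.1 r' = some e' → ∀ w ∈ e'.vars, w ≠ v := fun he w hw h =>
          hv _ _ he (h ▸ hw)
      · exact (h₁.mono hle).change fun r' e' he =>
          ⟨he, id, fun w hw => by simp [mask, hne he w hw]⟩
      · exact (h₂.mono hle).change fun r' e' he =>
          ⟨he, id, fun w hw => by simp [mask, hne he w hw]⟩
    · exact .of_continues hs (K := .assign v e :: K) hr hS hC h₁ h₂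
        (.cmd ⟨pe, r, C₁, lab, hst', hr₁, hI, rfl, hle, hv, hS.symm ▸ hg⟩ hK) hev
  | seq c₁ c₂ ih₁ ih₂ =>
    rintro C q C' K ⟨m, C₁, hc₁, hc₂⟩ hK hr hC h₁ h₂
    exact ih₁ hc₁ (K := c₂ :: K) (.cmd hc₂ hK) hr hC h₁ h₂
  | ite e c₁ c₂ ih₁ ih₂ =>
    rintro C q C' K ⟨pe, r, C₁, lab, br, hst, hr₁, hI, ⟨p₁, C₂, lab₁, ex, hc₁, hI₁, hex, hle⟩,
      hb₂⟩ hK hr hC h₁ h₂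
    rcases hstr hC hst with ⟨rfl, rfl⟩ | ⟨C₃, hS, hst', hev⟩
    · obtain ⟨p₂, C₃, lab₂, hc₂, hI₂, rfl, hle₂⟩ := hb₂
      -- The condition has one value on both sides, hence `jz` takes the same direction although the
      -- other registers may differ.
      have he := hr.eval_eq (Cmd.leftmost_fill K _)
      have e₁ := (h₁ _ _ hr₁).2
      have e₂ := (h₂ _ _ hr₁).2
      by_cases h0 : e.eval (mask N mem₁) = 0
      · exact ⟨_, _, _, _, _, _, hs.deterministic (.jzZero _ _ _ _ _ _ _ _ hI (e₁.trans h0)),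
          .jzZero _ _ _ _ _ _ _ _ hI (by rw [e₂, ← he, h0]), ⟨c₂ :: K, C,
          hr.step (.fill K (.iteFalse _ _ _ _ _ h0)) (.fill K (.iteFalse _ _ _ _ _ (he ▸ h0))),
          .cmd hc₂ (.epilogue hI₂ hle₂ hK), hC, h₁, h₂⟩, .silent⟩
      · exact ⟨_, _, _, _, _, _, hs.deterministic (.jzNonzero _ _ _ _ _ _ _ _ hI (e₁ ▸ h0)),
          .jzNonzero _ _ _ _ _ _ _ _ hI (by rwa [e₂, ← he]), ⟨c₁ :: K, C,
          hr.step (.fill K (.iteTrue _ _ _ _ _ h0)) (.fill K (.iteTrue _ _ _ _ _ (he ▸ h0))),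
          .cmd hc₁ (.jmp hI₁ hle (hex ▸ hK)), hC, h₁, h₂⟩, .silent⟩
    · exact .of_continues hs (K := .ite e c₁ c₂ :: K) hr hS hC h₁ h₂
        (.cmd ⟨pe, r, C₁, lab, br, hst', hr₁, hI, ⟨p₁, C₂, lab₁, ex, hc₁, hI₁, hex, hle⟩, hb₂⟩ hK)
        hev
  | loop e c ih =>
    rintro C q C' K ⟨p₀, pe, r, C₀, lab, ex, p₁, C₂, lab₁, lp, hle, hst, hst₀, hr₁, hI, hex, hc,
      hS₂, hI₁, hlp⟩ hK hr hC h₁ h₂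
    have hC₀ := hle.1.trans hC
    replace h₁ := h₁.mono hle
    replace h₂ := h₂.mono hle
    rcases hstr hC₀ hst with ⟨rfl, rfl⟩ | ⟨C₃, hS, hst', hev⟩
    -- Unfolding the loop has no RISC instruction of its own; it is performed together with the
    -- branch at `jz`.
    · have hr' := hr.step (.fill K (.loop ..)) (.fill K (.loop ..))
      have he := hr'.eval_eq (Cmd.leftmost_fill K _)
      have e₁ := (h₁ _ _ hr₁).2
      have e₂ := (h₂ _ _ hr₁).2
      by_cases h0 : e.eval (mask N mem₁) = 0
      · exact ⟨_, _, _, _, _, _, hs.deterministic (.jzZero _ _ _ _ _ _ _ _ hI (e₁.trans h0)),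
          .jzZero _ _ _ _ _ _ _ _ hI (by rw [e₂, ← he, h0]), ⟨K, C₀,
          (hr'.step (.fill K (.iteFalse _ _ _ _ _ h0))
            (.fill K (.iteFalse _ _ _ _ _ (he ▸ h0)))).start,
          hex ▸ hK, hC₀, h₁, h₂⟩, .silent⟩
      · refine ⟨_, _, _, _, _, _, hs.deterministic (.jzNonzero _ _ _ _ _ _ _ _ hI (e₁ ▸ h0)),
          .jzNonzero _ _ _ _ _ _ _ _ hI (by rwa [e₂, ← he]), ⟨c :: Cmd.loop e c :: K, C₀,
          hr'.step (.fill K (.iteTrue _ _ _ _ _ h0)) (.fill K (.iteTrue _ _ _ _ _ (he ▸ h0))),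
          -- The back edge forgets all register entries, and the body restores the assumptions, so
          -- the record at the loop head is recovered.
          .cmd hc (.jmp (C' := (fun _ => none, C.2)) hI₁ ⟨by rw [hS₂, hle.1], by simp⟩ (.cmd
            ⟨p₀, pc, r, (fun _ => none, C.2), lab, ex, p₁, C₂, lab₁, lp, .refl _,
              hlp.symm ▸ hst₀, hst₀, hr₁, hI, hex, hc, hS₂, hI₁, hlp⟩ hK)), hC₀, h₁, h₂⟩, .silent⟩
    · exact .of_continues hs (K := .loop e c :: K) hr hS hC₀ h₁ h₂
        (.cmd ⟨p₀, pe, r, C₃, lab, ex, p₁, C₂, lab₁, lp, .refl _, hst', by rwa [hS, hle.1],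
          hr₁, hI, hex, hc, hS₂, hI₁, hlp⟩ hK) hev

theorem ThreadInv.stepMatched (hD : D.WellFormed) (hN : Hidden D mds N)
    (hL : ∀ k, Sum.inl k ∉ mds Mode.asmNoRW)
    (h : ThreadInv D P pc regs₁ regs₂ mds (mask N mem₁) (mask N mem₂))
    (hs : EvalR D ((((pc, P), regs₁), mds), mem₁) lc) :
    StepMatched D N P pc regs₂ mds mem₁ mem₂ lc := by
  obtain ⟨K, C, hr, hK, hC, h₁, h₂⟩ := h
  cases hK with
  -- Here `pc` is the length of the text and no step exists.
  | nil => cases hs <;> simp_all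
  | cmd hc hK => exact .of_cmd hD hN hL hs _ hc hK hr hC h₁ h₂
  | jmp hI hle hK =>
    exact ⟨_, _, _, _, _, _, hs.deterministic (.jmp _ _ _ _ _ _ _ hI), .jmp _ _ _ _ _ _ _ hI,
      ⟨K, _, hr, hK, hle.1.trans hC, h₁.mono hle, h₂.mono hle⟩, .silent⟩
  | epilogue hI hle hK =>
    exact ⟨_, _, _, _, _, _, hs.deterministic (.nopEpilogue _ _ _ _ _ _ hI),
      .nopEpilogue _ _ _ _ _ _ hI,
      ⟨K, _, hr, hK, hle.1.trans hC, h₁.mono hle, h₂.mono hle⟩, .silent⟩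

end Local

/-! ## The whole system -/

section Global

/-- `Cvars` speaks of changing one variable. Finiteness of `X` allows `m` to be turned into `m'` one
variable at a time, and no single change affects the classification. -/
theorem dma_congr {X Val : Type*} [Finite X] {dma : Mem X Val → X → Sec} {x : X}
    {m m' : Mem X Val} (h : ∀ y ∈ Cvars dma x, m y = m' y) : dma m x = dma m' x := by
  classical
  have := Fintype.ofFinite X
  suffices H : ∀ s : Finset X, dma m x = dma (s.piecewise m' m) x by
    simpa using H Finset.univ
  intro s
  induction s using Finset.induction_on with
  | empty => simp
  | insert y s hy ih =>
    rw [ih, Finset.piecewise_insert]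
    -- If `y` controls `x`, the memories agree at `y` and nothing changes; otherwise a change of
    -- classification would make `y` a control variable.
    by_cases hc : y ∈ Cvars dma x
    · rw [← h y hc]
      congr 1
      funext z
      by_cases hz : z = y
      · subst hz; simp [hy]
      · simp [hz]
    · by_contra hne
      exact hc ⟨_, _, fun z hz => (Function.update_of_ne hz _ _).symm, hne⟩

variable {Lock Var Val Reg : Type*} {D : LockDiscipline Lock Var Val}

/-- The mode state of thread `i` when `h` tells which thread holds a lock. -/
def heldMds (D : LockDiscipline Lock Var Val) (h : Lock → Option ℕ) (i : ℕ) : Mds (Lock ⊕ Var)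
  | Mode.guarNoW => {x | ∃ k, h k ≠ some i ∧ x ∈ D.noW k}
  | Mode.asmNoW => {x | ∃ k, h k = some i ∧ x ∈ D.noW k}
  | Mode.guarNoRW => {x | ∃ k, h k ≠ some i ∧ x ∈ D.noRW k}
  | Mode.asmNoRW => {x | ∃ k, h k = some i ∧ x ∈ D.noRW k}

/-- The variables that another thread than `i` has exclusive permission to read. -/
def hiddenFrom (D : LockDiscipline Lock Var Val) (h : Lock → Option ℕ) (i : ℕ) :
    Set (Lock ⊕ Var) :=
  {x | ∃ k j, h k = some j ∧ j ≠ i ∧ x ∈ D.noRW k}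

theorem LockDiscipline.WellFormed.eq_of_mem (hD : D.WellFormed) {x : Lock ⊕ Var} {k k' : Lock}
    (h : x ∈ D.noW k ∪ D.noRW k) (h' : x ∈ D.noW k' ∪ D.noRW k') : k = k' := by
  rcases h with ⟨v, hv, rfl⟩ | ⟨v, hv, rfl⟩ <;> rcases h' with ⟨w, hw, hvw⟩ | ⟨w, hw, hvw⟩ <;>
    cases hvw <;> exact hD.lock_unique v k' (by simp [hw]) k (by simp [hv])

theorem exists_var_of_mem {x : Lock ⊕ Var} {k : Lock} (h : x ∈ D.noW k ∪ D.noRW k) :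
    ∃ v, x = Sum.inr v ∧ D.LockGoverned v := by
  rcases h with ⟨v, hv, rfl⟩ | ⟨v, hv, rfl⟩
  exacts [⟨v, rfl, k, .inl hv⟩, ⟨v, rfl, k, .inr hv⟩]

/-- Control variables are governed alike. -/
theorem LockDiscipline.WellFormed.control (hD : D.WellFormed) {x y : Lock ⊕ Var}
    (hy : y ∈ Cvars D.dma x) (k : Lock) :
    (y ∈ D.noW k ↔ x ∈ D.noW k) ∧ (y ∈ D.noRW k ↔ x ∈ D.noRW k) := by
  cases x with
  | inl l =>
    obtain ⟨m, m', -, hne⟩ := hy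
    exact (hne ((hD.lock_low l m).trans (hD.lock_low l m').symm)).elim
  | inr v =>
    cases y with
    | inl l => exact (hD.lock_not_control l ⟨_, hy⟩).elim
    | inr c => simpa [LockDiscipline.noW, LockDiscipline.noRW] using hD.control_same_lock c v k hy

theorem LockDiscipline.WellFormed.writable_control (hD : D.WellFormed) {h : Lock → Option ℕ}
    {i : ℕ} {x y : Lock ⊕ Var} (hy : y ∈ Cvars D.dma x) (hw : Writable (heldMds D h i) y) :
    Writable (heldMds D h i) x :=
  ⟨fun ⟨k, hk, hx⟩ => hw.1 ⟨k, hk, (hD.control hy k).1.2 hx⟩,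
    fun ⟨k, hk, hx⟩ => hw.2 ⟨k, hk, (hD.control hy k).2.2 hx⟩⟩

theorem exists_of_not_writable {h : Lock → Option ℕ} {i : ℕ} {x : Lock ⊕ Var}
    (hx : ¬ Writable (heldMds D h i) x) : ∃ k, h k = some i ∧ x ∈ D.noW k ∪ D.noRW k := by
  by_contra! H
  exact hx ⟨fun ⟨k, hk, hx⟩ => H k hk (.inl hx), fun ⟨k, hk, hx⟩ => H k hk (.inr hx)⟩

theorem heldMds_congr {h h' : Lock → Option ℕ} {i : ℕ} (H : ∀ k, h' k = some i ↔ h k = some i) :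
    heldMds D h' i = heldMds D h i := by
  funext m
  cases m <;> simp only [heldMds, ne_eq, H]

/-- The mode state determines who may release `k`: a lock governs at least one variable, and no
other lock governs that variable. -/
theorem lockHeldMdsCorrect_iff (hD : D.WellFormed) {h : Lock → Option ℕ} {i : ℕ} {k : Lock} :
    D.LockHeldMdsCorrect (heldMds D h i) k ↔ h k = some i := by
  constructor
  · intro H
    obtain ⟨v, hv⟩ := Set.nonempty_iff_ne_empty.2 (hD.not_vacuous k)
    rcases hv with hv | hv
    · have hv' : Sum.inr v ∈ D.noW k := ⟨v, hv, rfl⟩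
      obtain ⟨k', hk', hx⟩ := ((H _).1 hv').2
      rwa [hD.eq_of_mem (.inl hv') (.inl hx)]
    · have hv' : Sum.inr v ∈ D.noRW k := ⟨v, hv, rfl⟩
      obtain ⟨k', hk', hx⟩ := ((H _).2 hv').2
      rwa [hD.eq_of_mem (.inr hv') (.inr hx)]
  · refine fun hk x => ⟨fun hx => ⟨?_, k, hk, hx⟩, fun hx => ⟨?_, k, hk, hx⟩⟩
    · rintro ⟨k', hk', hx'⟩
      exact hk' (hD.eq_of_mem (.inl hx) (.inl hx') ▸ hk)
    · rintro ⟨k', hk', hx'⟩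
      exact hk' (hD.eq_of_mem (.inr hx) (.inr hx') ▸ hk)

theorem lockAcqUpd_heldMds [DecidableEq Lock] (hD : D.WellFormed) (h : Lock → Option ℕ) (i : ℕ)
    (k : Lock) :
    D.lockAcqUpd (heldMds D h i) k = heldMds D (Function.update h k (some i)) i := by
  have hW : ∀ {x k'}, x ∈ D.noW k → x ∈ D.noW k' → k' = k := fun a b =>
    hD.eq_of_mem (.inl b) (.inl a)
  have hRW : ∀ {x k'}, x ∈ D.noRW k → x ∈ D.noRW k' → k' = k := fun a b =>
    hD.eq_of_mem (.inr b) (.inr a)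
  funext m
  cases m <;> ext x <;>
    simp only [LockDiscipline.lockAcqUpd, heldMds, Set.mem_union, Set.mem_sdiff, Set.mem_ofPred_eq,
      Function.update_apply] <;> grind

theorem lockRelUpd_heldMds [DecidableEq Lock] (hD : D.WellFormed) (h : Lock → Option ℕ) (i : ℕ)
    (k : Lock) :
    D.lockRelUpd (heldMds D h i) k = heldMds D (Function.update h k none) i := by
  have hW : ∀ {x k'}, x ∈ D.noW k → x ∈ D.noW k' → k' = k := fun a b =>
    hD.eq_of_mem (.inl b) (.inl a)
  have hRW : ∀ {x k'}, x ∈ D.noRW k → x ∈ D.noRW k' → k' = k := fun a b =>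
    hD.eq_of_mem (.inr b) (.inr a)
  funext m
  cases m <;> ext x <;>
    simp only [LockDiscipline.lockRelUpd, heldMds, Set.mem_union, Set.mem_sdiff, Set.mem_ofPred_eq,
      Function.update_apply] <;> grind

theorem initMds_eq_heldMds (i : ℕ) : D.initMds = heldMds D (fun _ => none) i := by
  funext m
  cases m <;> ext x <;> simp [LockDiscipline.initMds, heldMds]

/-- A hidden variable has only one governing lock, and another thread holds it. -/
theorem hidden_hiddenFrom (hD : D.WellFormed) (h : Lock → Option ℕ) (i : ℕ) :
    Hidden D (heldMds D h i) (hiddenFrom D h i) := by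
  rintro x ⟨k, j, hk, hj, hx⟩
  refine ⟨exists_var_of_mem (.inr hx), ?_⟩
  rintro (⟨k', hk', hx'⟩ | ⟨k', hk', hx'⟩)
  · rw [hD.eq_of_mem (.inl hx') (.inr hx), hk] at hk'
    exact hj (Option.some.inj hk')
  · rw [hD.eq_of_mem (.inr hx') (.inr hx), hk] at hk'
    exact hj (Option.some.inj hk')

theorem lock_notMem_heldMds (h : Lock → Option ℕ) (i : ℕ) (k : Lock) :
    Sum.inl k ∉ heldMds D h i Mode.asmNoRW := by
  rintro ⟨k', -, hx⟩
  obtain ⟨v, hv, -⟩ := exists_var_of_mem (.inr hx)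
  cases hv

theorem writable_lock (h : Lock → Option ℕ) (i : ℕ) (k : Lock) :
    Writable (heldMds D h i) (Sum.inl k) := by
  by_contra H
  obtain ⟨k', -, hx⟩ := exists_of_not_writable H
  obtain ⟨v, hv, -⟩ := exists_var_of_mem hx
  cases hv

/-- A thread's own lock operations do not change what is hidden from it. -/
theorem hiddenFrom_congr {h h' : Lock → Option ℕ} {i : ℕ}
    (H : ∀ k j, j ≠ i → (h' k = some j ↔ h k = some j)) : hiddenFrom D h' i = hiddenFrom D h i := by
  ext x
  simp only [hiddenFrom, Set.mem_ofPred_eq]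
  grind

variable [Zero Val]

theorem dma_mask [Finite Lock] [Finite Var] (hD : D.WellFormed) {h : Lock → Option ℕ} {i : ℕ}
    {x : Lock ⊕ Var} (hx : x ∉ hiddenFrom D h i) (mem : Mem (Lock ⊕ Var) Val) :
    D.dma (mask (hiddenFrom D h i) mem) x = D.dma mem x :=
  dma_congr fun _ hy => mask_of_notMem (fun hy' => by
    obtain ⟨k, j, hk, hj, hyk⟩ := hy'
    exact hx ⟨k, j, hk, hj, (hD.control hy k).2.1 hyk⟩) _

/-- Registers stay correct because recorded expressions mention only variables with an assumption. A
variable that is not writable keeps its classification as well, since its control variables are not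
writable either. -/
theorem ThreadInv.change [Finite Lock] [Finite Var] (hD : D.WellFormed) {h : Lock → Option ℕ}
    {i : ℕ} {P : List (LInstr Lock Var Val Reg)} {pc : ℕ} {regs₁ regs₂ : Reg → Val}
    {m₁ m₂ m₁' m₂' : Mem (Lock ⊕ Var) Val}
    (H : ThreadInv D P pc regs₁ regs₂ (heldMds D h i) m₁ m₂)
    (h₁ : ∀ x, ¬ Writable (heldMds D h i) x → m₁ x = m₁' x)
    (h₂ : ∀ x, ¬ Writable (heldMds D h i) x → m₂ x = m₂' x)
    (hl : LowEqModulo D.dma (heldMds D h i) m₁ m₂ → LowEqModulo D.dma (heldMds D h i) m₁' m₂') :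
    ThreadInv D P pc regs₁ regs₂ (heldMds D h i) m₁' m₂' := by
  obtain ⟨K, C, hr, hK, hC, hC₁, hC₂⟩ := H
  refine ⟨K, C, hr.change (fun x hx => ?_) (hl hr.lowEqModulo), hK, hC, fun r e he => ?_,
    fun r e he => ?_⟩
  · by_contra hw
    rcases hx with hx | hx | hx
    · exact hx (h₁ x hw)
    · exact hx (h₂ x hw)
    · exact hx (dma_congr fun y hy => h₁ y fun hy' => hw (hD.writable_control hy hy'))
  · refine ⟨(hC₁ r e he).1, (hC₁ r e he).2.trans (e.eval_congr fun v hv => h₁ _ fun hw => ?_)⟩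
    have := (hC₁ r e he).1 v hv
    rw [hC] at this
    exact this.elim hw.1 hw.2
  · refine ⟨(hC₂ r e he).1, (hC₂ r e he).2.trans (e.eval_congr fun v hv => h₂ _ fun hw => ?_)⟩
    have := (hC₂ r e he).1 v hv
    rw [hC] at this
    exact this.elim hw.1 hw.2

/-- A change of lock holders from `h` to `h'` and of memory from `mem` to `mem'` is invisible to
thread `j` at the variables for which it has an assumption. -/
def SeenFrom (D : LockDiscipline Lock Var Val) (h h' : Lock → Option ℕ)
    (mem mem' : Mem (Lock ⊕ Var) Val) (j : ℕ) : Prop :=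
  ∀ x, ¬ Writable (heldMds D h j) x →
    mask (hiddenFrom D h j) mem x = mask (hiddenFrom D h' j) mem' x

/-- A variable for which `j` has an assumption is governed by a lock of `j`, hence not by `k`; a new
holder of `k` neither hides nor reveals it. -/
theorem seenFrom_update [DecidableEq Lock] [DecidableEq (Lock ⊕ Var)] (hD : D.WellFormed)
    {h : Lock → Option ℕ} {k : Lock} {j : ℕ} {o : Option ℕ} (hk : h k ≠ some j)
    (mem : Mem (Lock ⊕ Var) Val) (a : Val) :
    SeenFrom D h (Function.update h k o) mem (Function.update mem (Sum.inl k) a) j := by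
  intro x hx
  obtain ⟨k', hk', hx'⟩ := exists_of_not_writable hx
  have hxk : x ∉ D.noRW k := fun hxk => hk (hD.eq_of_mem hx' (.inr hxk) ▸ hk')
  have hxl : x ≠ Sum.inl k := fun h' => hx (h' ▸ writable_lock _ _ _)
  have hiff : x ∈ hiddenFrom D (Function.update h k o) j ↔ x ∈ hiddenFrom D h j := by
    simp only [hiddenFrom, Set.mem_ofPred_eq, Function.update_apply]
    grind
  by_cases hm : x ∈ hiddenFrom D h j
  · rw [mask_of_mem hm, mask_of_mem (hiff.2 hm)]
  · rw [mask_of_notMem hm, mask_of_notMem (hm ∘ hiff.1), Function.update_of_ne hxl]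

/-- All that the other threads need to know about a step of thread `i`; its code no longer matters
from here on. -/
theorem Effect.holders (hD : D.WellFormed) {h : Lock → Option ℕ} {i : ℕ} {mds'}
    {mem₁ mem₂ mem₁' mem₂' : Mem (Lock ⊕ Var) Val}
    (hlk : ∀ k, D.evLock (mem₁ (Sum.inl k)) ↔ h k ≠ none)
    (H : Effect D (heldMds D h i) mem₁ mem₂ mds' mem₁' mem₂') :
    ∃ h', mds' = heldMds D h' i ∧ (∀ k, D.evLock (mem₁' (Sum.inl k)) ↔ h' k ≠ none) ∧
      (∀ k j, j ≠ i → (h' k = some j ↔ h k = some j)) ∧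
      ∀ j, j ≠ i → SeenFrom D h h' mem₁ mem₁' j ∧ SeenFrom D h h' mem₂ mem₂' j := by
  classical
  cases H with
  | silent => exact ⟨h, rfl, hlk, fun _ _ _ => .rfl, fun _ _ => ⟨fun _ _ => rfl, fun _ _ => rfl⟩⟩
  | write v a b hv =>
    refine ⟨h, rfl, fun k => by simpa using hlk k, fun _ _ _ => .rfl, fun j hj => ?_⟩
    have key : ∀ x, ¬ Writable (heldMds D h j) x → x ≠ Sum.inr v := by
      rintro _ hx rfl
      obtain ⟨k, hk, hx'⟩ := exists_of_not_writable hx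
      rcases hv with hv | hv
      -- If `i` and `j` both had an assumption on `v`, they would hold the same lock.
      · obtain ⟨k', hk', hv'⟩ : ∃ k, h k = some i ∧ Sum.inr v ∈ D.noW k ∪ D.noRW k :=
          exists_of_not_writable fun hw => hv.elim hw.1 hw.2
        rw [hD.eq_of_mem hv' hx', hk] at hk'
        exact hj (Option.some.inj hk')
      · obtain ⟨w, hw, hw'⟩ := exists_var_of_mem hx'
        cases hw
        exact hv hw'
    exact ⟨fun x hx => by simp [mask, key x hx], fun x hx => by simp [mask, key x hx]⟩
  | acquire k hk =>
    have hk' : h k = none := by simpa [hlk] using hk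
    refine ⟨Function.update h k (some i), lockAcqUpd_heldMds hD h i k, fun k' => ?_,
      fun k' j hj => ?_, fun j hj => ⟨?_, ?_⟩⟩
    · by_cases hkk : k' = k
      · subst hkk; simp [hD.evLock_lockTrue]
      · simp [hkk, hlk]
    · by_cases hkk : k' = k
      · subst hkk; simp [hk', hj.symm]
      · simp [hkk]
    all_goals exact seenFrom_update hD (by simp [hk']) _ _
  | release k hk =>
    have hk' : h k = some i := (lockHeldMdsCorrect_iff hD).1 hk
    refine ⟨Function.update h k none, lockRelUpd_heldMds hD h i k, fun k' => ?_,
      fun k' j hj => ?_, fun j hj => ⟨?_, ?_⟩⟩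
    · by_cases hkk : k' = k
      · subst hkk; simp [hD.not_evLock_lockFalse]
      · simp [hkk, hlk]
    · by_cases hkk : k' = k
      · subst hkk; simp [hk', hj.symm]
      · simp [hkk]
    all_goals exact seenFrom_update hD (by simp [hk', hj.symm]) _ _

/-- Low-equivalence for thread `j` after a step of thread `i`. -/
theorem LowEqModulo.of_step [Finite Lock] [Finite Var] (hD : D.WellFormed)
    {h h' : Lock → Option ℕ} {i j : ℕ} (hij : j ≠ i) {mem₁ mem₂ mem₁' mem₂' : Mem (Lock ⊕ Var) Val}
    (hh : ∀ k j, j ≠ i → (h' k = some j ↔ h k = some j))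
    (h₁ : SeenFrom D h h' mem₁ mem₁' j) (h₂ : SeenFrom D h h' mem₂ mem₂' j)
    (hi : LowEqModulo D.dma (heldMds D h' i) (mask (hiddenFrom D h' i) mem₁')
      (mask (hiddenFrom D h' i) mem₂'))
    (hj : LowEqModulo D.dma (heldMds D h j) (mask (hiddenFrom D h j) mem₁)
      (mask (hiddenFrom D h j) mem₂)) :
    LowEqModulo D.dma (heldMds D h j) (mask (hiddenFrom D h' j) mem₁')
      (mask (hiddenFrom D h' j) mem₂') := by
  intro x hx
  by_cases hxj : x ∈ hiddenFrom D h' j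
  · rw [mask_of_mem hxj, mask_of_mem hxj]
  by_cases hxi : x ∈ hiddenFrom D h' i
  -- The holder can only be `j`, which then has an assumption on `x`. Equality is required only if
  -- `x` is a control variable, and it persists because `j`'s view of `x` has not changed.
  · obtain ⟨k, l, hk, hl, hxk⟩ := hxi
    obtain rfl : l = j := by
      by_contra hlj
      exact hxj ⟨k, l, hk, hlj, hxk⟩
    have hasm : x ∈ heldMds D h l Mode.asmNoRW := ⟨k, (hh k l hij).1 hk, hxk⟩
    have hc : x ∈ Cset D.dma := hx.resolve_right fun hx => hx.2 hasm
    rw [← h₁ x fun hw => hw.2 hasm, ← h₂ x fun hw => hw.2 hasm]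
    exact hj x (.inl hc)
  -- Now `x` is visible to both threads. It is readable for `i`, since an exclusive read permission
  -- of `i` would hide it from `j`; so the bisimulation of `i` gives the equality.
  · have := hi x (hx.imp id fun hx => ⟨?_, fun ⟨k, hk, hxk⟩ => hxj ⟨k, i, hk, hij.symm, hxk⟩⟩)
    · rw [mask_of_notMem hxi, mask_of_notMem hxi] at this
      rwa [mask_of_notMem hxj, mask_of_notMem hxj]
    · rw [dma_mask hD hxi, ← hx.1, dma_mask hD hxj]

end Global

/-! ### The invariant of two runs along one schedule -/

section System

variable {Lock Var Val Reg : Type*} [Zero Val] {D : LockDiscipline Lock Var Val}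

theorem ThreadInv.lowEqModulo {P : List (LInstr Lock Var Val Reg)} {pc : ℕ}
    {regs₁ regs₂ : Reg → Val} {mds : Mds (Lock ⊕ Var)} {m₁ m₂ : Mem (Lock ⊕ Var) Val}
    (h : ThreadInv D P pc regs₁ regs₂ mds m₁ m₂) : LowEqModulo D.dma mds m₁ m₂ := by
  obtain ⟨K, C, hr, -⟩ := h
  exact hr.lowEqModulo

/-- Thread `i` is in matching states in two systems. -/
def ThreadsMatch (D : LockDiscipline Lock Var Val) (h : Lock → Option ℕ) (i : ℕ)
    (cm₁ cm₂ : RiscTps Lock Var Val Reg × Mds (Lock ⊕ Var)) (mem₁ mem₂ : Mem (Lock ⊕ Var) Val) :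
    Prop :=
  ∃ P pc regs₁ regs₂, cm₁ = (((pc, P), regs₁), heldMds D h i) ∧
    cm₂ = (((pc, P), regs₂), heldMds D h i) ∧
    ThreadInv D P pc regs₁ regs₂ (heldMds D h i) (mask (hiddenFrom D h i) mem₁)
      (mask (hiddenFrom D h i) mem₂)

/-- The invariant of two runs of a system along one schedule. -/
structure SystemInv (D : LockDiscipline Lock Var Val) (h : Lock → Option ℕ)
    (gc₁ gc₂ : GlobalConf (RiscTps Lock Var Val Reg) (Lock ⊕ Var) Val) : Prop where
  length_eq : gc₁.1.length = gc₂.1.length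
  evLock_iff : ∀ k, D.evLock (gc₁.2 (Sum.inl k)) ↔ h k ≠ none
  lt_length : ∀ k j, h k = some j → j < gc₁.1.length
  lowEq_of_nil : gc₁.1.length = 0 → LowEq D.dma gc₁.2 gc₂.2
  threads : ∀ (i : ℕ) (h₁ : i < gc₁.1.length) (h₂ : i < gc₂.1.length),
    ThreadsMatch D h i gc₁.1[i] gc₂.1[i] gc₁.2 gc₂.2

theorem EvalSched.deterministic (sched : List ℕ) :
    ∀ {gc gc₁ gc₂ : GlobalConf (RiscTps Lock Var Val Reg) (Lock ⊕ Var) Val},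
    EvalSched (EvalR D) sched gc gc₁ → EvalSched (EvalR D) sched gc gc₂ → gc₁ = gc₂ := by
  induction sched with
  | nil => rintro gc gc₁ gc₂ rfl rfl; rfl
  | cons n ns ih =>
    rintro gc gc₁ gc₂ ⟨g, hs, hr⟩ ⟨g', hs', hr'⟩
    obtain rfl : g = g' := by
      cases hs with
      | step _ _ _ _ _ h =>
        cases hs' with
        | step _ _ _ _ _ h' =>
          have := h.deterministic h'
          simp only [Prod.mk.injEq] at this
          obtain ⟨rfl, rfl⟩ := this
          rfl
    exact ih hr hr'

theorem ThreadInv.init [Inhabited Reg] (hD : D.WellFormed) {R : RegAlloc Var Val Reg}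
    (hR : R.Correct) {c : Cmd Lock Var Val} {l : Option ℕ} {nl : ℕ}
    {PCs : AnnText Lock Var Val Reg} {l' : Option ℕ} {nl' : ℕ} {C' : Comprec Lock Var Val Reg}
    (regs : Reg → Val) {mem₁ mem₂ : Mem (Lock ⊕ Var) Val}
    (hc : ComSecure D.dma (EvalW D) D.NoLocksHeld NoHighBranching (c, D.initMds))
    (hcomp : (PCs, l', nl', C', false) = compileCmd D R initComprec l nl c)
    (hreq : CompilerInputReqs D (initComprec : Comprec Lock Var Val Reg) l nl c)
    (h₁ : D.NoLocksHeld mem₁) (h₂ : D.NoLocksHeld mem₂) (hlow : LowEq D.dma mem₁ mem₂) :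
    ThreadInv D (PCs.map Prod.fst) 0 regs regs D.initMds mem₁ mem₂ := by
  have hcomp' : compileCmdAux D R initComprec l nl c = (PCs, l', nl', C', false) := by
    rcases h : compileCmdAux D R initComprec l nl c with ⟨a₁, a₂, a₃, a₄, a₅⟩
    simp only [compileCmd, h, Prod.mk.injEq] at hcomp
    obtain ⟨rfl, rfl, rfl, rfl, hf⟩ := hcomp
    rw [(Bool.or_eq_false_iff.1 hf.symm).1]
  -- Control variables are always Low, so plain low-equivalence implies the modulo-modes one.
  obtain ⟨B, hB⟩ := hc mem₁ mem₂ (fun x hx => hlow x (hx.elim (fun hc => hD.control_low x hc _)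
    And.left)) h₁ h₂
  have hcode : CodeAt D (PCs.map Prod.fst) c initComprec 0 (PCs.map Prod.fst).length C' :=
    compileCmdAux_codeAt hR c [] [] hcomp' hreq.2.2.2 hreq.1 (by simp) rfl (by simp) (by simp)
      (by simp)
  exact ⟨[c], initComprec, ⟨B, hB⟩, .cmd hcode (.nil _), rfl, fun r e h => (by cases h),
    fun r e h => (by cases h)⟩

variable [Finite Lock] [Finite Var]

theorem SystemInv.step (hD : D.WellFormed) {h : Lock → Option ℕ}
    {gc₁ gc₂ gc₁' : GlobalConf (RiscTps Lock Var Val Reg) (Lock ⊕ Var) Val}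
    (H : SystemInv D h gc₁ gc₂) {n : ℕ} (hs : GlobalStep (EvalR D) n gc₁ gc₁') :
    ∃ h' gc₂', GlobalStep (EvalR D) n gc₂ gc₂' ∧ SystemInv D h' gc₁' gc₂' := by
  cases hs with
  | step cms₁ mem₁ cm₁' mem₁' hn hstep =>
    obtain ⟨cms₂, mem₂⟩ := gc₂
    obtain ⟨hlen, hev, hlt, hnil, hth⟩ := H
    simp only at hlen hev hlt hnil hth
    have hn₂ : n < cms₂.length := hlen ▸ hn
    obtain ⟨P, pc, regs₁, regs₂, e₁, e₂, hinv⟩ := hth n hn hn₂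
    rw [e₁] at hstep
    obtain ⟨pc', regs₁', regs₂', mds', mem₁'', mem₂', heq, hs₂, hinv', heff⟩ :=
      hinv.stepMatched hD (hidden_hiddenFrom hD h n) (lock_notMem_heldMds h n) hstep
    simp only [Prod.mk.injEq] at heq
    obtain ⟨rfl, rfl⟩ := heq
    obtain ⟨h', rfl, hev', hh, hseen⟩ := heff.holders hD hev
    -- The step was matched under the old mask of thread `n`; the new lock holders give it the same
    -- mask.
    rw [← hiddenFrom_congr (D := D) hh] at hinv'
    rw [← e₂] at hs₂
    refine ⟨h', _, .step cms₂ mem₂ _ _ hn₂ hs₂, by simpa using hlen, hev', fun k j hk => ?_,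
      fun h0 => ?_, fun j h₁ h₂ => ?_⟩
    · rw [List.length_set]
      by_cases hj : j = n
      · exact hj ▸ hn
      · exact hlt k j ((hh k j hj).1 hk)
    · simp only [List.length_set] at h0
      omega
    · simp only [List.length_set] at h₁ h₂
      by_cases hj : j = n
      · subst hj
        exact ⟨P, pc', regs₁', regs₂', by simp, by simp, hinv'⟩
      · obtain ⟨Q, qc, r₁, r₂, f₁, f₂, hj'⟩ := hth j h₁ h₂
        have hm : heldMds D h' j = heldMds D h j := heldMds_congr fun k => hh k j hj
        refine ⟨Q, qc, r₁, r₂, ?_, ?_, ?_⟩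
        · simp [List.getElem_set_ne (Ne.symm hj), f₁, hm]
        · simp [List.getElem_set_ne (Ne.symm hj), f₂, hm]
        · rw [hm]
          -- To thread `j` the step, including any masking or unmasking, is a globally consistent
          -- change.
          exact hj'.change hD (hseen j hj).1 (hseen j hj).2
            (.of_step hD hj hh (hseen j hj).1 (hseen j hj).2 hinv'.lowEqModulo)

theorem SystemInv.evalSched (hD : D.WellFormed) (sched : List ℕ) : ∀ {h : Lock → Option ℕ}
    {gc₁ gc₂ gc₁' : GlobalConf (RiscTps Lock Var Val Reg) (Lock ⊕ Var) Val},
    SystemInv D h gc₁ gc₂ → EvalSched (EvalR D) sched gc₁ gc₁' →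
    ∃ h' gc₂', EvalSched (EvalR D) sched gc₂ gc₂' ∧ SystemInv D h' gc₁' gc₂' := by
  induction sched with
  | nil =>
    rintro h gc₁ gc₂ gc₁' H rfl
    exact ⟨h, gc₂, rfl, H⟩
  | cons n ns ih =>
    rintro h gc₁ gc₂ gc₁' H ⟨gc, hs, hr⟩
    obtain ⟨h', gc', hs', H'⟩ := H.step hD hs
    obtain ⟨h'', gc₂', hr', H''⟩ := ih H' hr
    exact ⟨h'', gc₂', ⟨gc', hs', hr'⟩, H''⟩

theorem SystemInv.low_eq (hD : D.WellFormed) {h : Lock → Option ℕ}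
    {gc₁ gc₂ : GlobalConf (RiscTps Lock Var Val Reg) (Lock ⊕ Var) Val}
    (H : SystemInv D h gc₁ gc₂) {x : Lock ⊕ Var}
    (hx : x ∈ Cset D.dma ∨ (D.dma gc₁.2 x = Sec.low ∧
      ∀ (i : ℕ) (hi : i < gc₁.1.length), Readable gc₁.1[i].2 x)) : gc₁.2 x = gc₂.2 x := by
  rcases Nat.eq_zero_or_pos gc₁.1.length with h0 | h0
  · exact H.lowEq_of_nil h0 x (hx.elim (fun hc => hD.control_low x hc _) And.left)
  -- The witness is the holder of a lock with exclusive read permission on `x`, if there is one, and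
  -- otherwise any thread. For control variables the first case can occur even though `x` is not
  -- readable there.
  have hi : ∃ i, i < gc₁.1.length ∧ x ∉ hiddenFrom D h i := by
    by_cases hk : ∃ k j, h k = some j ∧ x ∈ D.noRW k
    · obtain ⟨k, j, hk, hxk⟩ := hk
      refine ⟨j, H.lt_length k j hk, fun ⟨k', j', hk', hj', hxk'⟩ => hj' ?_⟩
      rw [hD.eq_of_mem (.inr hxk) (.inr hxk'), hk'] at hk
      exact Option.some.inj hk
    · exact ⟨0, h0, fun ⟨k, j, hk', _, hxk⟩ => hk ⟨k, j, hk', hxk⟩⟩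
  obtain ⟨i, hi, hxi⟩ := hi
  obtain ⟨P, pc, regs₁, regs₂, e₁, e₂, hinv⟩ := H.threads i hi (H.length_eq ▸ hi)
  have := hinv.lowEqModulo x (hx.imp id fun hx => ⟨(dma_mask hD hxi _).trans hx.1, ?_⟩)
  · rwa [mask_of_notMem hxi, mask_of_notMem hxi] at this
  · have := hx.2 i hi
    rwa [e₁] at this

end System
end CVDNI

open CVDNI in
theorem mainTheorem7 {Lock Var Val Reg : Type*} [Finite Lock] [Finite Var] [Zero Val]
    [Inhabited Reg]
    (D : LockDiscipline Lock Var Val) (hD : D.WellFormed)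
    (R : RegAlloc Var Val Reg) (hR : R.Correct)
    (cmsr : List (RiscTps Lock Var Val Reg × Mds (Lock ⊕ Var)))
    (h : ∀ (i : ℕ) (hi : i < cmsr.length),
      ∃ (c : Cmd Lock Var Val) (l : Option ℕ) (nl : ℕ) (PCs : AnnText Lock Var Val Reg)
        (l' : Option ℕ) (nl' : ℕ) (C' : Comprec Lock Var Val Reg) (regs : Reg → Val),
        ComSecure D.dma (EvalW D) D.NoLocksHeld NoHighBranching (c, D.initMds) ∧
        (PCs, l', nl', C', false) = compileCmd D R initComprec l nl c ∧
        CompilerInputReqs D (initComprec : Comprec Lock Var Val Reg) l nl c ∧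
        cmsr[i] = (((0, PCs.map Prod.fst), regs), D.initMds)) :
    SysSecure D.dma (EvalR D) D.NoLocksHeld cmsr := by
  intro mem₁ mem₂ h₁ h₂ hlow sched cms₁' mem₁' hrun
  have hinit : SystemInv D (fun _ => none) (cmsr, mem₁) (cmsr, mem₂) := by
    refine ⟨rfl, fun k => by simpa using h₁ k, by simp, fun _ => hlow, fun i hi _ => ?_⟩
    obtain ⟨c, l, nl, PCs, l', nl', C', regs, hc, hcomp, hreq, hi'⟩ := h i hi
    have hmask : ∀ mem : Mem (Lock ⊕ Var) Val,
        mask (hiddenFrom D (fun _ => none) i) mem = mem := fun mem => by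
      funext x
      exact mask_of_notMem (by rintro ⟨k, j, hk, -⟩; cases hk) mem
    refine ⟨PCs.map Prod.fst, 0, regs, regs, ?_, ?_, ?_⟩
    · rw [← initMds_eq_heldMds]; exact hi'
    · rw [← initMds_eq_heldMds]; exact hi'
    · simp only [← initMds_eq_heldMds, hmask]
      exact .init hD hR regs hc hcomp hreq h₁ h₂ hlow
  obtain ⟨h', ⟨cms₂', mem₂'⟩, hrun₂, hinv⟩ := hinit.evalSched hD sched hrun
  refine ⟨⟨cms₂', mem₂', hrun₂⟩, fun cms₂'' mem₂'' hrun₂' => ?_⟩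
  -- The claim is about every run from `mem₂`; determinism leaves only the one constructed.
  obtain ⟨rfl, rfl⟩ := Prod.mk.inj (EvalSched.deterministic sched hrun₂ hrun₂')
  refine ⟨hinv.length_eq, List.ext_getElem (by simpa using hinv.length_eq) fun i hi₁ hi₂ => ?_,
    fun x hx => hinv.low_eq hD hx⟩
  rw [List.length_map] at hi₁ hi₂
  obtain ⟨P, pc, regs₁, regs₂, e₁, e₂, -⟩ := hinv.threads i hi₁ hi₂
  simp only at e₁ e₂
  rw [List.getElem_map, List.getElem_map, e₁, e₂]
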